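/- All graphs are finite and simple, and a class of graphs is hereditary if it is closed under isomorphism and under taking induced subgraphs. A balanced separator of an $n$-vertex graph $G$ is a set $X\subseteq V(G)$ such that each component of $G-X$ has at most $2n/3$ vertices; $s(G)$ is the minimum size of a balanced separator of $G$, and for a class $\mathcal G$ let $s_{\mathcal G}(n)=\max\{s(G): G\in\mathcal G,\ |V(G)|\le n\}$ (with value $0$ if there is no such graph). An $r$-shallow minor of $G$ is a graph obtained from a subgraph of $G$ by contracting pairwise vertex-disjoint subgraphs, each of radius at most $r$; $\nabla_{\mathcal G}(r)\in[0,\infty]$ is the supremum of the densities $|E(H)|/|V(H)|$ over all $r$-shallow minors $H$ of graphs in $\mathcal G$. For $0<\varepsilon\le 1$, let $B_\varepsilon$ be the infimum (in the extended reals) of the real numbers $B$ such that every hereditary class $\mathcal G$ with $s_{\mathcal G}(n)=\Theta(n^{1-\varepsilon})$ satisfies $\nabla_{\mathcal G}(r)=O(r^B)$. For an $m$-vertex graph $G$ and $0<\varepsilon<1$, let $G^\varepsilon$ be the graph obtained from $G$ by subdividing each edge $\lceil m^{\varepsilon/(1-\varepsilon)}\rceil$ times. **Theorem.** For every $0<\varepsilon\le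 1$ we have $B_\varepsilon\ge \frac1\varepsilon-1$, and in fact $$B_\varepsilon=\frac1\varepsilon-1 .$$ Moreover, if $\varepsilon<1$, let $\mathcal W_\varepsilon$ be the class of all induced subgraphs of the graphs $G^\varepsilon$, over all graphs $G$. Then $\mathcal W_\varepsilon$ is hereditary; $s_{\mathcal W_\varepsilon}(n)=\Theta(n^{1-\varepsilon})$; for every integer $r\ge 0$ and $m=\lfloor r^{1/\varepsilon-1}\rfloor$, the graph $K_m^\varepsilon$ contains $K_m$ as an $r$-shallow minor; and $\nabla_{\mathcal W_\varepsilon}(r)=\Omega(r^{1/\varepsilon-1})$. -/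

import Mathlib

open Filter Asymptotics
open scoped ENNReal

/-- A finite graph, up to isomorphism: a simple graph on `Fin n` for some `n`. -/
abbrev FinGraph : Type := Σ n : ℕ, SimpleGraph (Fin n)

/-- A class of finite graphs is hereditary if it is closed under (isomorphic copies of)
induced subgraphs. -/
def IsHereditary (𝒢 : Set FinGraph) : Prop :=
  ∀ G ∈ 𝒢, ∀ H : FinGraph, Nonempty (H.2 ↪g G.2) → H ∈ 𝒢

/-- `X` is a balanced separator of the `n`-vertex graph `G`: each connected component of `G - X`
has at most `2n/3` vertices. -/
def IsBalancedSeparator {V : Type} [Fintype V] (G : SimpleGraph V) (X : Finset V) : Prop :=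
  ∀ c : (G.induce {v | v ∉ X}).ConnectedComponent,
    (c.supp.ncard : ℝ) ≤ 2 * (Fintype.card V : ℝ) / 3

/-- `s(G)`: the minimum size of a balanced separator of `G`. -/
noncomputable def sepNumber {V : Type} [Fintype V] (G : SimpleGraph V) : ℕ :=
  sInf {k | ∃ X : Finset V, IsBalancedSeparator G X ∧ X.card = k}

/-- The whole vertex set is a balanced separator, so the minimum in `sepNumber` is over a
nonempty set. -/
theorem isBalancedSeparator_univ {V : Type} [Fintype V] (G : SimpleGraph V) :
    IsBalancedSeparator G Finset.univ := by
  intro c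
  obtain ⟨v, -⟩ := c.nonempty_supp
  exact absurd (Finset.mem_univ v.1) v.2

theorem sepNumber_le_card {V : Type} [Fintype V] (G : SimpleGraph V) :
    sepNumber G ≤ Fintype.card V :=
  Nat.sInf_le ⟨Finset.univ, isBalancedSeparator_univ G, rfl⟩

/-- `s_𝒢(n)`: the maximum of `s(G)` over the graphs `G ∈ 𝒢` with at most `n` vertices
(`0` if there are none). -/
noncomputable def classSep (𝒢 : Set FinGraph) (n : ℕ) : ℕ :=
  sSup {k | ∃ G ∈ 𝒢, G.1 ≤ n ∧ sepNumber G.2 = k}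

/-- The set whose maximum defines `classSep` is bounded. -/
theorem bddAbove_classSep (𝒢 : Set FinGraph) (n : ℕ) :
    BddAbove {k | ∃ G ∈ 𝒢, G.1 ≤ n ∧ sepNumber G.2 = k} := by
  refine ⟨n, ?_⟩
  rintro k ⟨G, -, hn, rfl⟩
  exact (sepNumber_le_card G.2).trans (by simpa using hn)

/-- `H` is an `r`-shallow minor of `G`: there are pairwise disjoint vertex sets `B w` of `G`, one
for each vertex `w` of `H`, each inducing a subgraph of radius at most `r` (in particular
nonempty and connected), such that whenever `u` and `w` are adjacent in `H`, some edge of `G`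
joins `B u` to `B w`. Edges of `G` between other sets, and vertices in none of the sets, are
deleted before contracting. -/
def IsShallowMinor {W V : Type} (r : ℕ) (H : SimpleGraph W) (G : SimpleGraph V) : Prop :=
  ∃ B : W → Set V,
    (∀ w, (G.induce (B w)).radius ≤ (r : ℕ∞)) ∧
    (∀ u w, u ≠ w → Disjoint (B u) (B w)) ∧
    ∀ u w, H.Adj u w → ∃ x ∈ B u, ∃ y ∈ B w, G.Adj x y

/-- The density `|E(H)| / |V(H)|` (equal to `0` for the graph without vertices). -/
noncomputable def density (H : FinGraph) : ℝ≥0∞ :=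
  (H.2.edgeSet.ncard : ℝ≥0∞) / (H.1 : ℝ≥0∞)

/-- `∇_r(G)`: the maximum density of an `r`-shallow minor of `G`. -/
noncomputable def nabla (r : ℕ) (G : FinGraph) : ℝ≥0∞ :=
  ⨆ (H : FinGraph) (_ : IsShallowMinor r H.2 G.2), density H

/-- `∇_𝒢(r)`: the supremum of `∇_r(G)` over `G ∈ 𝒢`, possibly infinite. -/
noncomputable def classNabla (𝒢 : Set FinGraph) (r : ℕ) : ℝ≥0∞ :=
  ⨆ G ∈ 𝒢, nabla r G

/-- `s_𝒢(n) = Θ(n^(1-ε))`. -/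
def HasSepExponent (𝒢 : Set FinGraph) (ε : ℝ) : Prop :=
  (fun n : ℕ => (classSep 𝒢 n : ℝ)) =Θ[atTop] fun n : ℕ => (n : ℝ) ^ (1 - ε)

/-- `∇_𝒢(r) = O(r^B)`. -/
def NablaIsBigO (𝒢 : Set FinGraph) (B : ℝ) : Prop :=
  ∃ C : ℝ, ∀ᶠ r : ℕ in atTop, classNabla 𝒢 r ≤ ENNReal.ofReal (C * (r : ℝ) ^ B)

/-- `∇_𝒢(r) = Ω(r^b)`. -/
def NablaIsBigOmega (𝒢 : Set FinGraph) (b : ℝ) : Prop :=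
  ∃ c : ℝ, 0 < c ∧ ∀ᶠ r : ℕ in atTop, ENNReal.ofReal (c * (r : ℝ) ^ b) ≤ classNabla 𝒢 r

/-- `B_ε`: the infimum, in the extended reals, of the real numbers `B` for which every hereditary
class `𝒢` with `s_𝒢(n) = Θ(n^(1-ε))` satisfies `∇_𝒢(r) = O(r^B)`. -/
noncomputable def expansionExponent (ε : ℝ) : EReal :=
  ⨅ (B : ℝ) (_ : ∀ 𝒢 : Set FinGraph, IsHereditary 𝒢 → HasSepExponent 𝒢 ε → NablaIsBigO 𝒢 B),
    (B : EReal)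

/-- The edges of `G`, each written with its smaller end first. -/
abbrev OrientedEdge {V : Type} [LinearOrder V] (G : SimpleGraph V) : Type :=
  {e : V × V // e.1 < e.2 ∧ G.Adj e.1 e.2}

/-- The `i`-th vertex (`0 ≤ i ≤ t + 1`) of the path that replaces the edge `e` when every edge is
subdivided `t` times: the smaller end of `e`, then the `t` new vertices, then the larger end. -/
def subdivisionPath {V : Type} [LinearOrder V] {G : SimpleGraph V} (t : ℕ)
    (e : OrientedEdge G) (i : ℕ) : V ⊕ (OrientedEdge G × Fin t) :=
  if i = 0 then Sum.inl e.1.1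
  else if h : i - 1 < t then Sum.inr (e, ⟨i - 1, h⟩)
  else Sum.inl e.1.2

/-- The graph obtained from `G` by subdividing each edge `t` times: two vertices are adjacent iff
they are consecutive on one of the paths replacing the edges of `G`. -/
def subdivide {V : Type} [LinearOrder V] (G : SimpleGraph V) (t : ℕ) :
    SimpleGraph (V ⊕ (OrientedEdge G × Fin t)) :=
  SimpleGraph.fromRel fun x y =>
    ∃ e : OrientedEdge G, ∃ i ≤ t, x = subdivisionPath t e i ∧ y = subdivisionPath t e (i + 1)

/-- The number `⌈m^(ε/(1-ε))⌉` of times each edge of an `m`-vertex graph is subdivided. -/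
noncomputable def subdivisionCount (ε : ℝ) (m : ℕ) : ℕ :=
  ⌈(m : ℝ) ^ (ε / (1 - ε))⌉₊

/-- The graph `G^ε`. -/
noncomputable def epsSubdivision (ε : ℝ) {m : ℕ} (G : SimpleGraph (Fin m)) :
    SimpleGraph (Fin m ⊕ (OrientedEdge G × Fin (subdivisionCount ε m))) :=
  subdivide G (subdivisionCount ε m)

/-- The class `𝒢^ε` of all induced subgraphs of the graphs `G^ε` for `G ∈ 𝒢`. -/
def epsSubdivisionClass (ε : ℝ) (𝒢 : Set FinGraph) : Set FinGraph :=
  {H | ∃ G ∈ 𝒢, Nonempty (H.2 ↪g epsSubdivision ε G.2)}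

/-!
The expansion exponent is bounded from above by turning dense shallow minors into sparse ones.
A graph of density `ρ` has a densest part `U`, in a sense that slightly favours small sets; no
few vertices cut `U` in a balanced way without destroying a `|U| ^ (-δ)`-fraction of its edges,
since otherwise one of the two smaller sides would be denser (`exists_expanding_subset`). A greedy
hitting set for the edge sets of the `4 ^ |U|` possible cuts is a subgraph of `U` with only
`O(|U| ^ (1 + δ))` edges that still has no balanced cut of `|U| ^ (1 - δ)` vertices
(`exists_sparse_expander`). If the graph is an `r`-shallow minor of a member of a hereditary class,
these few edges, with `k = |U|`, are realized in an induced subgraph with `O(r k ^ (1 + δ))`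
vertices (`exists_small_minor_model`). Its separators, iterated on the heavy side so as to balance
the branch sets instead of the vertices, have total order `O((r k ^ (1 + δ)) ^ α)` and cut the minor
(`hasWeightedSeparation_of_pow`, `exists_cut_of_minor_model`). Hence `k ^ (1 - δ)` is at most that,
and `ρ = O(k)` is at most `r` to an exponent tending to `α / (1 - α)` as `δ → 0`; now let `α` tend
to `1 - ε` (`nablaIsBigO_of_hasSepExponent`).

For the lower bound, `K_m` is an `r`-shallow minor of its subdivision as soon as `m` is at most
`r ^ (1 / ε - 1)`. What has to be shown is that the subdivided graphs have separators of the right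
order. An induced subgraph with `n` vertices becomes a forest of subdivided stars and paths after
deleting either all `m` original vertices, or one end of each of the at most
`n / m ^ (ε / (1 - ε))` fully present edges; one of the two numbers is at most `n ^ (1 - ε)`
(`classSep_epsSubdivisionClass_le`). Conversely the hitting set argument, applied to `K_m`, gives an
expander with `m` vertices and `O(m)` edges, whose subdivision has `n = O(m ^ (1 / (1 - ε)))`
vertices. A cut of the expander needs a constant fraction of the `m` vertices, and is assembled from
a bounded number `I` of separators of graphs with at most `n` vertices, followed by separators of
pieces that are so small, with at most `(2 / 3) ^ I * n` vertices, that the upper bound makes their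
contribution negligible (`exists_le_classSep_epsSubdivisionClass`). For `ε = 1` the graphs with at
most two vertices show that the exponent is not negative.
-/

/-! ### Hitting sets -/

/-- Averaging: if every set `I i` contains a `θ`-fraction of `E`, some element of `E` lies in a
`θ`-fraction of the sets. -/
theorem exists_mem_many {α ι : Type*} [DecidableEq α] {E : Finset α} (hE : E.Nonempty)
    {s : Finset ι} {I : ι → Finset α} {θ : ℝ} (hI : ∀ i ∈ s, I i ⊆ E)
    (hθ : ∀ i ∈ s, θ * E.card ≤ (I i).card) :
    ∃ p ∈ E, θ * s.card ≤ (s.filter fun i => p ∈ I i).card := by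
  by_contra! hcon
  have h1 : (∑ p ∈ E, ((s.filter fun i => p ∈ I i).card : ℝ)) < ∑ _p ∈ E, θ * s.card :=
    Finset.sum_lt_sum_of_nonempty hE hcon
  have h2 : (∑ p ∈ E, ((s.filter fun i => p ∈ I i).card : ℝ)) = ∑ i ∈ s, ((I i).card : ℝ) := by
    have := Finset.sum_card_bipartiteAbove_eq_sum_card_bipartiteBelow (s := E) (t := s)
      (fun p i => p ∈ I i)
    simp only [Finset.bipartiteAbove, Finset.bipartiteBelow] at this
    rw [← Nat.cast_sum, this, Nat.cast_sum]
    refine Finset.sum_congr rfl fun i hi => ?_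
    congr 2
    ext p
    simp only [Finset.mem_filter]
    exact ⟨fun h => h.2, fun h => ⟨hI i hi h, h⟩⟩
  have h3 : (∑ _i ∈ s, θ * E.card) ≤ ∑ i ∈ s, ((I i).card : ℝ) := Finset.sum_le_sum hθ
  rw [h2] at h1
  simp only [Finset.sum_const, nsmul_eq_mul] at h1 h3
  linarith [mul_left_comm (E.card : ℝ) θ (s.card : ℝ), mul_comm (s.card : ℝ) (θ * E.card),
    mul_assoc θ (E.card : ℝ) (s.card : ℝ)]

/-- After `j` greedy choices at most a `(1 - θ) ^ j`-fraction of the sets is not hit. -/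
theorem exists_partial_hittingSet {α ι : Type*} [DecidableEq α] {E : Finset α} (hE : E.Nonempty)
    {s : Finset ι} {I : ι → Finset α} {θ : ℝ} (hθ1 : θ ≤ 1) (hI : ∀ i ∈ s, I i ⊆ E)
    (hθ : ∀ i ∈ s, θ * E.card ≤ (I i).card) (j : ℕ) :
    ∃ F ⊆ E, F.card ≤ j ∧
      ((s.filter fun i => ∀ p ∈ F, p ∉ I i).card : ℝ) ≤ (1 - θ) ^ j * s.card := by
  induction j with
  | zero => exact ⟨∅, by simp, by simp, by simp⟩
  | succ j ih =>
    obtain ⟨F, hFE, hFj, hF⟩ := ih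
    set u := s.filter fun i => ∀ p ∈ F, p ∉ I i with hu
    obtain ⟨p, hp, hpu⟩ := exists_mem_many hE (s := u) (I := I) (θ := θ)
      (fun i hi => hI i (Finset.mem_filter.1 hi).1) (fun i hi => hθ i (Finset.mem_filter.1 hi).1)
    refine ⟨insert p F, Finset.insert_subset hp hFE,
      (Finset.card_insert_le _ _).trans (by omega), ?_⟩
    have h1 : (s.filter fun i => ∀ q ∈ insert p F, q ∉ I i) = u.filter fun i => ¬ p ∈ I i := by
      ext i
      simp only [hu, Finset.mem_filter, Finset.mem_insert, forall_eq_or_imp]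
      tauto
    have h2 := Finset.card_filter_add_card_filter_not (s := u) (fun i => p ∈ I i)
    have h2' : ((u.filter fun i => p ∈ I i).card : ℝ) + (u.filter fun i => ¬ p ∈ I i).card
        = u.card := by exact_mod_cast h2
    rw [h1]
    calc ((u.filter fun i => ¬ p ∈ I i).card : ℝ) ≤ (1 - θ) * u.card := by linarith
      _ ≤ (1 - θ) * ((1 - θ) ^ j * s.card) := mul_le_mul_of_nonneg_left hF (by linarith)
      _ = (1 - θ) ^ (j + 1) * s.card := by ring

/-- Sets that each contain a `θ`-fraction of `E` are all hit by some `F ⊆ E` of size at most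
`log (number of sets) / θ + 1`. -/
theorem exists_hittingSet {α ι : Type*} [DecidableEq α] {E : Finset α}
    {s : Finset ι} {I : ι → Finset α} {θ : ℝ} (hθ0 : 0 < θ) (hE : E.Nonempty)
    (hI : ∀ i ∈ s, I i ⊆ E) (hθ : ∀ i ∈ s, θ * E.card ≤ (I i).card) :
    ∃ F ⊆ E, (F.card : ℝ) ≤ Real.log s.card / θ + 1 ∧ ∀ i ∈ s, ∃ p ∈ F, p ∈ I i := by
  rcases s.eq_empty_or_nonempty with rfl | hs
  · exact ⟨∅, by simp, by simp, by simp⟩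
  have hs0 : (0 : ℝ) < s.card := by exact_mod_cast hs.card_pos
  have hE0 : (0 : ℝ) < E.card := by exact_mod_cast hE.card_pos
  have hθ1 : θ ≤ 1 := by
    obtain ⟨i, hi⟩ := hs
    have h1 := hθ i hi
    have h2 : ((I i).card : ℝ) ≤ E.card := by exact_mod_cast Finset.card_le_card (hI i hi)
    by_contra! h
    nlinarith
  have hlog : 0 ≤ Real.log s.card / θ :=
    div_nonneg (Real.log_natCast_nonneg _) hθ0.le
  obtain ⟨F, hFE, hFj, hF⟩ := exists_partial_hittingSet hE hθ1 hI hθ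
    (⌊Real.log s.card / θ⌋₊ + 1)
  refine ⟨F, hFE, ?_, ?_⟩
  · have : (F.card : ℝ) ≤ (⌊Real.log s.card / θ⌋₊ + 1 : ℕ) := by exact_mod_cast hFj
    push_cast at this
    linarith [Nat.floor_le hlog]
  · set j := ⌊Real.log s.card / θ⌋₊ + 1 with hj
    have hjl : Real.log s.card < θ * j := by
      have := Nat.lt_floor_add_one (Real.log s.card / θ)
      rw [div_lt_iff₀ hθ0] at this
      rw [hj]; push_cast; linarith
    have h1 : (1 - θ) ^ j * s.card < 1 := by
      have h2 : (1 - θ) ^ j ≤ Real.exp (-(θ * j)) := by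
        have : 1 - θ ≤ Real.exp (-θ) := by linarith [Real.add_one_le_exp (-θ)]
        calc (1 - θ) ^ j ≤ Real.exp (-θ) ^ j := pow_le_pow_left₀ (by linarith) this _
          _ = Real.exp (-(θ * j)) := by rw [← Real.exp_nat_mul]; ring_nf
      have h3 : (s.card : ℝ) < Real.exp (θ * j) := by
        rwa [← Real.log_lt_iff_lt_exp hs0]
      calc (1 - θ) ^ j * s.card ≤ Real.exp (-(θ * j)) * s.card :=
            mul_le_mul_of_nonneg_right h2 hs0.le
        _ < Real.exp (-(θ * j)) * Real.exp (θ * j) :=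
            mul_lt_mul_of_pos_left h3 (Real.exp_pos _)
        _ = 1 := by rw [← Real.exp_add]; simp
    have h0 : (s.filter fun i => ∀ p ∈ F, p ∉ I i).card = 0 := by
      have : ((s.filter fun i => ∀ p ∈ F, p ∉ I i).card : ℝ) < 1 := hF.trans_lt h1
      exact_mod_cast Nat.lt_one_iff.1 (by exact_mod_cast this)
    rw [Finset.card_eq_zero, Finset.filter_eq_empty_iff] at h0
    intro i hi
    have := h0 hi
    push Not at this
    exact this

theorem four_pow_le_exp (k : ℕ) : (4 : ℝ) ^ k ≤ Real.exp (2 * k) := by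
  rw [mul_comm, Real.exp_nat_mul]
  refine pow_le_pow_left₀ (by norm_num) ?_ _
  have : Real.exp 2 = Real.exp 1 * Real.exp 1 := by rw [← Real.exp_add]; norm_num
  rw [this]
  nlinarith [Real.add_one_le_exp (1 : ℝ)]

/-! ### A sparse expander in every dense graph -/

/-- The arcs of `H` inside `U`: each edge of `H` with both ends in `U` is counted in both
directions. -/
noncomputable def arcs {V : Type*} (H : SimpleGraph V) (U : Finset V) : Finset (V × V) :=
  open scoped Classical in (U ×ˢ U).filter fun p => H.Adj p.1 p.2

/-- The arcs of `H` between `A` and `B`, in both directions. -/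
noncomputable def crossArcs {V : Type*} (H : SimpleGraph V) (A B : Finset V) : Finset (V × V) :=
  open scoped Classical in
    (A ×ˢ B ∪ B ×ˢ A).filter fun p => H.Adj p.1 p.2

theorem mem_arcs {V : Type*} {H : SimpleGraph V} {U : Finset V} {p : V × V} :
    p ∈ arcs H U ↔ (p.1 ∈ U ∧ p.2 ∈ U) ∧ H.Adj p.1 p.2 := by
  simp [arcs]

theorem mem_crossArcs {V : Type*} {H : SimpleGraph V} {A B : Finset V} {p : V × V} :
    p ∈ crossArcs H A B ↔
      ((p.1 ∈ A ∧ p.2 ∈ B) ∨ (p.1 ∈ B ∧ p.2 ∈ A)) ∧ H.Adj p.1 p.2 := by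
  simp [crossArcs]

theorem card_arcs_le {V : Type*} (H : SimpleGraph V) (U : Finset V) :
    (arcs H U).card ≤ U.card * U.card := by
  classical
  exact (Finset.card_filter_le _ _).trans (by rw [Finset.card_product])

theorem card_arcs_le_add {V : Type*} [DecidableEq V] (H : SimpleGraph V) {U A B : Finset V}
    (hAB : Disjoint A B) :
    (arcs H U).card ≤ (arcs H (U \ B)).card + (arcs H (U \ A)).card + (crossArcs H A B).card := by
  have h : arcs H U ⊆ arcs H (U \ B) ∪ arcs H (U \ A) ∪ crossArcs H A B := by
    intro p hp
    simp only [Finset.mem_union, mem_arcs, mem_crossArcs, Finset.mem_sdiff] at hp ⊢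
    have h1 : p.1 ∈ A → p.1 ∉ B := fun h => Finset.disjoint_left.1 hAB h
    have h2 : p.2 ∈ A → p.2 ∉ B := fun h => Finset.disjoint_left.1 hAB h
    tauto
  exact (Finset.card_le_card h).trans ((Finset.card_union_le _ _).trans
    (Nat.add_le_add_right (Finset.card_union_le _ _) _))

theorem card_arcs_univ {V : Type*} [Fintype V] (H : SimpleGraph V) :
    (arcs H Finset.univ).card = 2 * H.edgeSet.ncard := by
  classical
  have h1 : H.edgeSet.ncard = H.edgeFinset.card := by
    rw [← SimpleGraph.coe_edgeFinset, Set.ncard_coe_finset]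
  rw [h1, ← SimpleGraph.dart_card_eq_twice_card_edges, ← Finset.card_univ]
  symm
  refine Finset.card_bij (fun d _ => d.toProd) ?_ ?_ ?_
  · intro d _; simp [mem_arcs, d.adj]
  · intro d _ e _ h; exact SimpleGraph.Dart.ext _ _ h
  · intro p hp
    exact ⟨⟨p, (mem_arcs.1 hp).2⟩, Finset.mem_univ _, rfl⟩

/-- A densest set of vertices, density being weighted by the slightly decreasing factor
`1 + c |U| ^ (-δ)`, cannot be cut by few vertices without losing many edges: both sides of a
balanced cut, together with the cut vertices, would be at most as dense, and they are smaller by a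
constant factor. -/
theorem exists_expanding_subset {δ : ℝ} (hδ : 0 < δ) :
    ∃ c : ℝ, 0 < c ∧ ∃ x₀ : ℝ, 0 < x₀ ∧
      ∀ {V : Type} [Fintype V] [DecidableEq V] [Nonempty V] (H : SimpleGraph V),
        ∃ U : Finset V, U.Nonempty ∧
          (2 * H.edgeSet.ncard : ℝ) / Fintype.card V ≤ (1 + c) * ((arcs H U).card / U.card) ∧
          ((U.card : ℝ) ^ (-δ) ≤ x₀ → ∀ A ⊆ U, ∀ B ⊆ U, Disjoint A B →
            (A.card : ℝ) ≤ 2 * U.card / 3 → (B.card : ℝ) ≤ 2 * U.card / 3 →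
            ((U \ (A ∪ B)).card : ℝ) ≤ U.card * (U.card : ℝ) ^ (-δ) →
            (U.card : ℝ) ^ (-δ) * (arcs H U).card ≤ (crossArcs H A B).card) := by
  set q : ℝ := (5 / 4 : ℝ) ^ δ with hq
  have hq1 : 1 < q := Real.one_lt_rpow (by norm_num) hδ
  set c : ℝ := 6 / (q - 1) with hc
  have hc0 : 0 < c := div_pos (by norm_num) (by linarith)
  have hcq : c * (q - 1) = 6 := by rw [hc]; field_simp [show q - 1 ≠ 0 by linarith]
  -- with `x = |U| ^ (-δ)`, the three bounds give `c (q - 1 - x) ≥ 3`, `1 + c q x ≤ 2`, and sides of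
  -- at most `2 / 3 + 1 / 12 < 4 / 5` of all vertices even with the cut vertices added
  refine ⟨c, hc0, min ((q - 1) / 2) (min (1 / (c * q)) (1 / 12)),
    lt_min (by linarith) (lt_min (by positivity) (by norm_num)), ?_⟩
  intro V _ _ _ H
  let Φ : Finset V → ℝ := fun U => (arcs H U).card / U.card * (1 + c * (U.card : ℝ) ^ (-δ))
  obtain ⟨U, hU, hmax⟩ := Finset.exists_max_image
    ((Finset.univ : Finset (Finset V)).filter fun U => U.Nonempty) Φ
    ⟨Finset.univ, by simp⟩
  have hUne : U.Nonempty := (Finset.mem_filter.1 hU).2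
  replace hmax : ∀ W : Finset V, W.Nonempty → Φ W ≤ Φ U := fun W hW => hmax W (by simpa using hW)
  have hk1 : (1 : ℝ) ≤ U.card := by exact_mod_cast hUne.card_pos
  have hk0 : (0 : ℝ) < U.card := by linarith
  refine ⟨U, hUne, ?_, ?_⟩
  · have h1 : Φ Finset.univ ≤ Φ U := hmax _ Finset.univ_nonempty
    have h2 : (2 * H.edgeSet.ncard : ℝ) / Fintype.card V ≤ Φ Finset.univ := by
      have h3 : ((arcs H Finset.univ).card : ℝ) = 2 * H.edgeSet.ncard := by
        exact_mod_cast card_arcs_univ H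
      simp only [Φ, h3, Finset.card_univ]
      refine le_mul_of_one_le_right (by positivity) ?_
      have : 0 ≤ c * (Fintype.card V : ℝ) ^ (-δ) := by positivity
      linarith
    have h4 : Φ U ≤ (1 + c) * ((arcs H U).card / U.card) := by
      simp only [Φ]
      rw [mul_comm]
      refine mul_le_mul_of_nonneg_right ?_ (by positivity)
      have : (U.card : ℝ) ^ (-δ) ≤ 1 := Real.rpow_le_one_of_one_le_of_nonpos hk1 (by linarith)
      nlinarith
    linarith
  · intro hx A hA B hB hAB hA2 hB2 hS
    set k : ℝ := (U.card : ℝ) with hk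
    set x : ℝ := k ^ (-δ) with hxdef
    have hx0 : 0 < x := Real.rpow_pos_of_pos hk0 _
    have hx1 : x ≤ (q - 1) / 2 := hx.trans (min_le_left _ _)
    have hx2 : c * q * x ≤ 1 := by
      have h := hx.trans ((min_le_right _ _).trans (min_le_left _ _))
      rw [le_div_iff₀ (by positivity)] at h
      linarith
    have hx3 : x ≤ 1 / 12 := hx.trans ((min_le_right _ _).trans (min_le_right _ _))
    have hsum : (A.card : ℝ) + B.card + (U \ (A ∪ B)).card = k := by
      rw [hk, ← Nat.cast_add, ← Nat.cast_add, ← Finset.card_union_of_disjoint hAB, add_comm,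
        Finset.card_sdiff_add_card_eq_card (Finset.union_subset hA hB)]
    have hUA : ((U \ A).card : ℝ) = k - A.card := by
      rw [Finset.card_sdiff_of_subset hA, Nat.cast_sub (Finset.card_le_card hA)]
    have hUB : ((U \ B).card : ℝ) = k - B.card := by
      rw [Finset.card_sdiff_of_subset hB, Nat.cast_sub (Finset.card_le_card hB)]
    -- each side together with the cut vertices has between `k / 3` and `4 k / 5` vertices,
    -- which gains the factor `q = (5 / 4) ^ δ` in `|U| ^ (-δ)`
    have key : ∀ W : Finset V, k / 3 ≤ (W.card : ℝ) → (W.card : ℝ) ≤ 4 / 5 * k →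
        (arcs H W).card * (1 + c * q * x) ≤ (arcs H U).card * (1 + c * x) * (W.card / k) := by
      intro W hW1 hW2
      have hW0 : (0 : ℝ) < W.card := by linarith
      have h1 : Φ W ≤ Φ U := hmax W (Finset.card_pos.1 (by exact_mod_cast hW0))
      have h2 : q * x ≤ (W.card : ℝ) ^ (-δ) := by
        have h3 : (4 / 5 * k) ^ (-δ) ≤ (W.card : ℝ) ^ (-δ) :=
          Real.rpow_le_rpow_of_nonpos hW0 hW2 (by linarith)
        have h4 : (4 / 5 * k) ^ (-δ) = q * x := by
          rw [Real.mul_rpow (by norm_num) hk0.le, hq, Real.rpow_neg (by norm_num),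
            ← Real.inv_rpow (by norm_num), ← hxdef]
          norm_num
        linarith
      have h5 : ((arcs H W).card : ℝ) / W.card * (1 + c * q * x) ≤ Φ W := by
        refine mul_le_mul_of_nonneg_left ?_ (by positivity)
        nlinarith
      have h6 : ((arcs H W).card : ℝ) / W.card * (1 + c * q * x)
          ≤ (arcs H U).card / k * (1 + c * x) := h5.trans h1
      calc (arcs H W).card * (1 + c * q * x)
          = ((arcs H W).card : ℝ) / W.card * (1 + c * q * x) * W.card := by field_simp
        _ ≤ (arcs H U).card / k * (1 + c * x) * W.card := mul_le_mul_of_nonneg_right h6 hW0.le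
        _ = (arcs H U).card * (1 + c * x) * (W.card / k) := by ring
    have hkx : k * x ≤ k / 12 := by nlinarith
    have keyA := key (U \ B) (by linarith) (by linarith)
    have keyB := key (U \ A) (by linarith) (by linarith)
    have hcard : ((arcs H U).card : ℝ) ≤ (arcs H (U \ B)).card + (arcs H (U \ A)).card
        + (crossArcs H A B).card := by exact_mod_cast card_arcs_le_add H hAB
    set E : ℝ := ((arcs H U).card : ℝ) with hE
    set e : ℝ := ((crossArcs H A B).card : ℝ) with he
    have hE0 : 0 ≤ E := by positivity
    have he0 : 0 ≤ e := by positivity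
    have hcx : 0 < c * x := by positivity
    have h7 : ((U \ B).card : ℝ) / k + (U \ A).card / k ≤ 1 + x := by
      rw [← add_div, div_le_iff₀ hk0]
      linarith
    have h8 : (E - e) * (1 + c * q * x) ≤ E * (1 + c * x) * (1 + x) := by
      have h9 : (E - e) * (1 + c * q * x) ≤
          ((arcs H (U \ B)).card + (arcs H (U \ A)).card) * (1 + c * q * x) :=
        mul_le_mul_of_nonneg_right (by linarith) (by positivity)
      have h10 : E * (1 + c * x) * (((U \ B).card : ℝ) / k + (U \ A).card / k) ≤
          E * (1 + c * x) * (1 + x) := mul_le_mul_of_nonneg_left h7 (by positivity)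
      linarith
    -- `c (q - 1 - x) ≥ c (q - 1) / 2 = 3`
    have h11 : 3 ≤ c * (q - 1 - x) := by nlinarith
    have h12 : E * x * (c * (q - 1 - x) - 1) ≤ e * (1 + c * q * x) := by
      have : E * (1 + c * q * x) - E * (1 + c * x) * (1 + x)
        = E * x * (c * (q - 1 - x) - 1) := by ring
      linarith
    have h13 : E * x * 2 ≤ E * x * (c * (q - 1 - x) - 1) :=
      mul_le_mul_of_nonneg_left (by linarith) (by positivity)
    have h14 : e * (1 + c * q * x) ≤ e * 2 := mul_le_mul_of_nonneg_left (by linarith) he0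
    linarith

/-- Every graph of density `ρ` contains, on a vertex set `U` of size `k ≥ ρ / D`, a subgraph `F`
with at most `D k ^ (1 + δ)` edges in which no `k ^ (1 - δ)` vertices form a balanced cut, unless
`ρ ≤ D`. The subgraph is a hitting set for the edge sets of the balanced cuts of a densest `U`. -/
theorem exists_sparse_expander {δ : ℝ} (hδ : 0 < δ) :
    ∃ D : ℝ, 0 < D ∧ ∀ {V : Type} [Fintype V] [DecidableEq V] [Nonempty V] (H : SimpleGraph V),
      (H.edgeSet.ncard : ℝ) / Fintype.card V ≤ D ∨
      ∃ U : Finset V, ∃ F : Finset (V × V), U.Nonempty ∧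
        (H.edgeSet.ncard : ℝ) / Fintype.card V ≤ D * U.card ∧
        (F.card : ℝ) ≤ 3 * (U.card : ℝ) ^ (1 + δ) ∧
        (∀ p ∈ F, (p.1 ∈ U ∧ p.2 ∈ U) ∧ H.Adj p.1 p.2) ∧
        ∀ A ⊆ U, ∀ B ⊆ U, Disjoint A B →
          (A.card : ℝ) ≤ 2 * U.card / 3 → (B.card : ℝ) ≤ 2 * U.card / 3 →
          ((U \ (A ∪ B)).card : ℝ) ≤ (U.card : ℝ) ^ (1 - δ) →
          ∃ p ∈ F, (p.1 ∈ A ∧ p.2 ∈ B) ∨ (p.1 ∈ B ∧ p.2 ∈ A) := by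
  classical
  obtain ⟨c, hc0, x₀, hx₀, h⟩ := exists_expanding_subset hδ
  set K : ℝ := x₀ ^ (-(1 / δ)) with hK
  have hK0 : 0 < K := Real.rpow_pos_of_pos hx₀ _
  refine ⟨(1 + c) * (1 + K), by positivity, ?_⟩
  intro V _ _ _ H
  obtain ⟨U, hU, hdens, hexp⟩ := h H
  have hk1 : (1 : ℝ) ≤ U.card := by exact_mod_cast hU.card_pos
  set k : ℝ := (U.card : ℝ) with hk
  have hk0 : 0 < k := by linarith
  set ρ : ℝ := (H.edgeSet.ncard : ℝ) / Fintype.card V with hρ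
  have hρ0 : 0 ≤ ρ := by positivity
  have hρk : ρ ≤ (1 + c) * k := by
    have h1 : ((arcs H U).card : ℝ) / k ≤ k := by
      rw [div_le_iff₀ hk0, hk]
      exact_mod_cast card_arcs_le H U
    have h2 : 2 * ρ ≤ (1 + c) * k := by
      have : 2 * ρ = (2 * H.edgeSet.ncard : ℝ) / Fintype.card V := by rw [hρ]; ring
      rw [this]
      exact hdens.trans (mul_le_mul_of_nonneg_left h1 (by linarith))
    linarith
  by_cases hx : k ^ (-δ) ≤ x₀
  swap
  · left
    have h1 : k ≤ K := by
      have h2 : (k ^ (-δ)) ^ (-(1 / δ)) ≤ x₀ ^ (-(1 / δ)) :=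
        Real.rpow_le_rpow_of_nonpos hx₀ (not_le.1 hx).le (by simp [hδ.le])
      rwa [← Real.rpow_mul hk0.le, show -δ * -(1 / δ) = 1 by field_simp, Real.rpow_one] at h2
    nlinarith
  rcases (arcs H U).eq_empty_or_nonempty with hE | hE
  · left
    have : 2 * ρ ≤ 0 := by
      have h3 : 2 * ρ = (2 * H.edgeSet.ncard : ℝ) / Fintype.card V := by rw [hρ]; ring
      rw [h3]
      refine hdens.trans ?_
      simp [hE]
    have : 0 ≤ (1 + c) * (1 + K) := by positivity
    linarith
  right
  set s : Finset (Finset V × Finset V) := (U.powerset ×ˢ U.powerset).filter fun P =>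
    Disjoint P.1 P.2 ∧ (P.1.card : ℝ) ≤ 2 * k / 3 ∧ (P.2.card : ℝ) ≤ 2 * k / 3 ∧
      ((U \ (P.1 ∪ P.2)).card : ℝ) ≤ k ^ (1 - δ) with hs
  have hkδ : k * k ^ (-δ) = k ^ (1 - δ) := by
    rw [sub_eq_add_neg, Real.rpow_add hk0, Real.rpow_one]
  obtain ⟨F, hFE, hFc, hF⟩ := exists_hittingSet (E := arcs H U) (s := s)
    (I := fun P => crossArcs H P.1 P.2) (θ := k ^ (-δ)) (Real.rpow_pos_of_pos hk0 _) hE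
    (by
      intro P hP p hp
      simp only [hs, Finset.mem_filter, Finset.mem_product, Finset.mem_powerset] at hP
      rw [mem_crossArcs] at hp
      rw [mem_arcs]
      refine ⟨?_, hp.2⟩
      rcases hp.1 with h1 | h1
      · exact ⟨hP.1.1 h1.1, hP.1.2 h1.2⟩
      · exact ⟨hP.1.2 h1.1, hP.1.1 h1.2⟩)
    (by
      intro P hP
      simp only [hs, Finset.mem_filter, Finset.mem_product, Finset.mem_powerset] at hP
      obtain ⟨⟨h1, h2⟩, h3, h4, h5, h6⟩ := hP
      exact hexp hx _ h1 _ h2 h3 h4 h5 (by rw [hkδ]; exact h6))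
  refine ⟨U, F, hU, ?_, ?_, fun p hp => mem_arcs.1 (hFE hp), ?_⟩
  · refine hρk.trans (mul_le_mul_of_nonneg_right ?_ hk0.le)
    nlinarith
  · have h1 : Real.log s.card ≤ 2 * k := by
      rcases s.eq_empty_or_nonempty with h0 | h0
      · rw [h0]; simp; positivity
      have h2 : (s.card : ℝ) ≤ 4 ^ U.card := by
        have : s.card ≤ 2 ^ U.card * 2 ^ U.card :=
          (Finset.card_filter_le _ _).trans (by rw [Finset.card_product, Finset.card_powerset])
        rw [← mul_pow] at this
        exact_mod_cast this
      have h3 : (s.card : ℝ) ≤ Real.exp (2 * k) := h2.trans (four_pow_le_exp _)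
      exact (Real.log_le_iff_le_exp (by exact_mod_cast h0.card_pos)).2 h3
    have h4 : Real.log s.card / k ^ (-δ) ≤ 2 * k ^ (1 + δ) := by
      rw [div_le_iff₀ (Real.rpow_pos_of_pos hk0 _), mul_assoc, ← Real.rpow_add hk0]
      simpa using h1
    have h5 : 1 ≤ k ^ (1 + δ) := Real.one_le_rpow hk1 (by linarith)
    linarith
  · intro A hA B hB hAB h1 h2 h3
    obtain ⟨p, hp, hp2⟩ := hF (A, B) (by
      simp only [hs, Finset.mem_filter, Finset.mem_product, Finset.mem_powerset]
      exact ⟨⟨hA, hB⟩, hAB, h1, h2, h3⟩)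
    exact ⟨p, hp, (mem_crossArcs.1 hp2).1⟩

/-! ### Separations -/

/-- `(A, S, B)` is a separation of `G[W]`: deleting `S` from `W` leaves the disjoint union of `A`
and `B`, with no edge of `G` between `A` and `B`. (The set `S` need not be contained in `W`.) -/
def IsSeparation {V : Type*} [DecidableEq V] (G : SimpleGraph V) (W A S B : Finset V) : Prop :=
  A ∪ B = W \ S ∧ Disjoint A B ∧ ∀ a ∈ A, ∀ b ∈ B, ¬ G.Adj a b

/-- Items of weight at most `2 n / 3` each and at most `n` in total can be split into two groups of
weight at most `2 n / 3` each: take a heaviest group not exceeding that bound. -/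
theorem exists_balanced_grouping {ι : Type*} [Fintype ι] [DecidableEq ι] (w : ι → ℝ) {n : ℝ}
    (hw0 : ∀ i, 0 ≤ w i) (hw : ∀ i, w i ≤ 2 * n / 3) (hn : ∑ i, w i ≤ n) :
    ∃ T : Finset ι, ∑ i ∈ T, w i ≤ 2 * n / 3 ∧ ∑ i ∈ Tᶜ, w i ≤ 2 * n / 3 := by
  have hn0 : 0 ≤ n := (Finset.sum_nonneg fun i _ => hw0 i).trans hn
  obtain ⟨T, hT, hmax⟩ := Finset.exists_max_image
    ((Finset.univ : Finset (Finset ι)).filter fun T => ∑ i ∈ T, w i ≤ 2 * n / 3)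
    (fun T => ∑ i ∈ T, w i) ⟨∅, by simp; positivity⟩
  replace hT := (Finset.mem_filter.1 hT).2
  replace hmax : ∀ T' : Finset ι, ∑ i ∈ T', w i ≤ 2 * n / 3 → ∑ i ∈ T', w i ≤ ∑ i ∈ T, w i :=
    fun T' h => hmax T' (by simpa using h)
  refine ⟨T, hT, ?_⟩
  by_contra! hc
  have hsum := Finset.sum_add_sum_compl T w
  have hne : (Tᶜ).Nonempty := by
    by_contra h
    rw [Finset.not_nonempty_iff_eq_empty] at h
    rw [h] at hc
    simp at hc
    linarith
  obtain ⟨j, hj⟩ := hne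
  have hjT : j ∉ T := Finset.mem_compl.1 hj
  have h1 := hmax {j} (by simpa using hw j)
  rw [Finset.sum_singleton] at h1
  by_cases h2 : ∑ i ∈ insert j T, w i ≤ 2 * n / 3
  · -- then `w j = 0` for all `j` outside `T`
    by_cases h3 : ∀ i ∈ Tᶜ, w i = 0
    · rw [Finset.sum_eq_zero h3] at hc
      linarith
    · push Not at h3
      obtain ⟨i, hi, hi0⟩ := h3
      have hiT : i ∉ T := Finset.mem_compl.1 hi
      have hipos := lt_of_le_of_ne (hw0 i) (Ne.symm hi0)
      have h4 := hmax {i} (by simpa using hw i)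
      rw [Finset.sum_singleton] at h4
      have h5 := hmax (insert i T) (by rw [Finset.sum_insert hiT]; linarith)
      rw [Finset.sum_insert hiT] at h5
      linarith
  · rw [Finset.sum_insert hjT] at h2
    linarith

/-- The components left by a balanced separator can be grouped into the two sides of a
separation. -/
theorem exists_separation_of_isBalancedSeparator {V : Type} [Fintype V] [DecidableEq V]
    {G : SimpleGraph V} {X : Finset V} (hX : IsBalancedSeparator G X) :
    ∃ A B : Finset V, IsSeparation G Finset.univ A X B ∧
      (A.card : ℝ) ≤ 2 * Fintype.card V / 3 ∧ (B.card : ℝ) ≤ 2 * Fintype.card V / 3 := by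
  classical
  set G' := G.induce {v | v ∉ X} with hG'
  set n : ℝ := (Fintype.card V : ℝ) with hn
  have hcount : ∀ T : Finset G'.ConnectedComponent,
      ((Finset.univ.filter fun v : V => ∃ h : v ∉ X, G'.connectedComponentMk ⟨v, h⟩ ∈ T).card : ℝ)
        = ∑ c ∈ T, (c.supp.ncard : ℝ) := by
    intro T
    have h1 : (Finset.univ.filter fun v : V => ∃ h : v ∉ X, G'.connectedComponentMk ⟨v, h⟩ ∈ T)
        = T.biUnion fun c => c.supp.toFinset.map (Function.Embedding.subtype _) := by
      ext v
      simp only [Finset.mem_filter, Finset.mem_univ, true_and, Finset.mem_biUnion, Finset.mem_map,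
        Set.mem_toFinset, SimpleGraph.ConnectedComponent.mem_supp_iff,
        Function.Embedding.coe_subtype, Subtype.exists, exists_and_right, exists_eq_right]
      constructor
      · rintro ⟨h, h'⟩; exact ⟨_, h', h, rfl⟩
      · rintro ⟨c, hc, h, rfl⟩; exact ⟨h, hc⟩
    rw [h1, Finset.card_biUnion]
    · push_cast
      refine Finset.sum_congr rfl fun c _ => ?_
      rw [Finset.card_map, Set.ncard_eq_toFinset_card']
    · intro c _ d _ hcd
      rw [Function.onFun, Finset.disjoint_map, Set.disjoint_toFinset]
      exact G'.pairwise_disjoint_supp_connectedComponent hcd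
  have huniv := hcount Finset.univ
  have hle : ∑ c : G'.ConnectedComponent, (c.supp.ncard : ℝ) ≤ n := by
    rw [← huniv, hn]
    exact_mod_cast Finset.card_le_univ _
  obtain ⟨T, hT, hT'⟩ := exists_balanced_grouping
    (fun c : G'.ConnectedComponent => (c.supp.ncard : ℝ)) (n := n) (fun _ => by positivity) hX hle
  refine ⟨Finset.univ.filter fun v : V => ∃ h : v ∉ X, G'.connectedComponentMk ⟨v, h⟩ ∈ T,
    Finset.univ.filter fun v : V => ∃ h : v ∉ X, G'.connectedComponentMk ⟨v, h⟩ ∈ Tᶜ,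
    ⟨?_, ?_, ?_⟩, ?_, ?_⟩
  · ext v
    simp only [Finset.mem_union, Finset.mem_filter, Finset.mem_univ, true_and, Finset.mem_compl,
      Finset.mem_sdiff]
    constructor
    · rintro (⟨h, -⟩ | ⟨h, -⟩) <;> exact h
    · intro h
      by_cases h' : G'.connectedComponentMk ⟨v, h⟩ ∈ T
      · exact Or.inl ⟨h, h'⟩
      · exact Or.inr ⟨h, h'⟩
  · rw [Finset.disjoint_left]
    intro v hv hv'
    obtain ⟨-, h, h1⟩ := Finset.mem_filter.1 hv
    obtain ⟨-, h', h2⟩ := Finset.mem_filter.1 hv'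
    exact Finset.mem_compl.1 h2 h1
  · intro a ha b hb hab
    obtain ⟨-, h, h1⟩ := Finset.mem_filter.1 ha
    obtain ⟨-, h', h2⟩ := Finset.mem_filter.1 hb
    refine Finset.mem_compl.1 h2 ?_
    have hadj : G'.Adj ⟨a, h⟩ ⟨b, h'⟩ := hab
    rwa [← SimpleGraph.ConnectedComponent.connectedComponentMk_eq_of_adj hadj]
  · rw [hcount]; exact hT
  · rw [hcount]; exact hT'

/-- In a graph all of whose induced subgraphs lie in `𝒢`, every vertex set `W` has a balanced
separation of order at most `s_𝒢(|W|)`. -/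
theorem exists_separation_of_class {V : Type} [DecidableEq V] {𝒢 : Set FinGraph}
    {G : SimpleGraph V} (hG : ∀ H : FinGraph, Nonempty (H.2 ↪g G) → H ∈ 𝒢) (W : Finset V) :
    ∃ A S B : Finset V, IsSeparation G W A S B ∧
      (A.card : ℝ) ≤ 2 * W.card / 3 ∧ (B.card : ℝ) ≤ 2 * W.card / 3 ∧
      S.card ≤ classSep 𝒢 W.card := by
  let f : Fin W.card ↪ V := W.equivFin.symm.toEmbedding.trans (Function.Embedding.subtype _)
  let H : FinGraph := ⟨W.card, G.comap f⟩
  have hH : H ∈ 𝒢 := hG H ⟨SimpleGraph.Embedding.comap f G⟩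
  have hfW : Finset.univ.map f = W := by
    ext v
    simp only [f, Finset.mem_map, Finset.mem_univ, true_and]
    constructor
    · rintro ⟨i, rfl⟩; exact (W.equivFin.symm i).2
    · intro hv; exact ⟨W.equivFin ⟨v, hv⟩, by simp⟩
  obtain ⟨X, hX, hXc⟩ := Nat.sInf_mem
    (s := {k | ∃ X : Finset (Fin W.card), IsBalancedSeparator H.2 X ∧ X.card = k})
    ⟨_, Finset.univ, isBalancedSeparator_univ _, rfl⟩
  obtain ⟨A, B, ⟨hAB, hd, hadj⟩, hA, hB⟩ := exists_separation_of_isBalancedSeparator hX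
  refine ⟨A.map f, X.map f, B.map f, ⟨?_, (Finset.disjoint_map f).2 hd, ?_⟩, ?_, ?_, ?_⟩
  · rw [← Finset.map_union, hAB, Finset.map_sdiff, hfW]
  · intro a ha b hb
    obtain ⟨a, ha', rfl⟩ := Finset.mem_map.1 ha
    obtain ⟨b, hb', rfl⟩ := Finset.mem_map.1 hb
    exact hadj a ha' b hb'
  · simpa using hA
  · simpa using hB
  · rw [Finset.card_map, hXc]
    exact le_csSup (bddAbove_classSep 𝒢 _) ⟨H, hH, le_rfl, rfl⟩

/-- `G[W]` has a separation of order at most `c` with at most `2 τ / 3` vertices of `T` on each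
side; here `τ` stands for an upper bound on `|W ∩ T|` that stays fixed when `W` shrinks. -/
def HasWeightedSeparation {V : Type*} [DecidableEq V] (G : SimpleGraph V) (T : Finset V) (τ : ℝ)
    (W : Finset V) (c : ℝ) : Prop :=
  ∃ A S B : Finset V, IsSeparation G W A S B ∧ ((A ∩ T).card : ℝ) ≤ 2 * τ / 3 ∧
    ((B ∩ T).card : ℝ) ≤ 2 * τ / 3 ∧ (S.card : ℝ) ≤ c

theorem IsSeparation.symm {V : Type*} [DecidableEq V] {G : SimpleGraph V} {W A S B : Finset V}
    (h : IsSeparation G W A S B) : IsSeparation G W B S A :=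
  ⟨by rw [Finset.union_comm, h.1], h.2.1.symm, fun b hb a ha hab => h.2.2 a ha b hb hab.symm⟩

theorem HasWeightedSeparation.mono {V : Type*} [DecidableEq V] {G : SimpleGraph V} {T W : Finset V}
    {τ c d : ℝ} (h : HasWeightedSeparation G T τ W c) (hcd : c ≤ d) :
    HasWeightedSeparation G T τ W d := by
  obtain ⟨A, S, B, h1, h2, h3, h4⟩ := h
  exact ⟨A, S, B, h1, h2, h3, h4.trans hcd⟩

/-- If the side `A` of a separation of `W` is too heavy, separating `A` further leaves three parts;
the two lightest together have weight at most two thirds of the total. -/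
theorem HasWeightedSeparation.of_heavy_side {V : Type*} [DecidableEq V] {G : SimpleGraph V}
    {T W A S B : Finset V} {τ s c : ℝ} (h : IsSeparation G W A S B) (hS : (S.card : ℝ) ≤ s)
    (hT : ((W ∩ T).card : ℝ) ≤ τ) (hA : 2 * τ / 3 < (A ∩ T).card)
    (hAc : HasWeightedSeparation G T τ A c) : HasWeightedSeparation G T τ W (s + c) := by
  obtain ⟨A', S', B', ⟨h1, h2, h3⟩, h4, h5, h6⟩ := hAc
  obtain ⟨g1, g2, g3⟩ := h
  have hA' : A' ⊆ A := fun x hx =>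
    (Finset.mem_sdiff.1 (h1 ▸ Finset.mem_union_left B' hx : x ∈ A \ S')).1
  have hB' : B' ⊆ A := fun x hx =>
    (Finset.mem_sdiff.1 (h1 ▸ Finset.mem_union_right A' hx : x ∈ A \ S')).1
  have hsum : ((A ∩ T).card : ℝ) + (B ∩ T).card ≤ τ := by
    have e1 : (A ∩ T).card + (B ∩ T).card ≤ (W ∩ T).card := by
      rw [← Finset.card_union_of_disjoint
        (g2.mono Finset.inter_subset_left Finset.inter_subset_left),
        ← Finset.union_inter_distrib_right,
        g1]
      exact Finset.card_le_card (Finset.inter_subset_inter_right Finset.sdiff_subset)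
    have e2 : ((A ∩ T).card : ℝ) + (B ∩ T).card ≤ (W ∩ T).card := by exact_mod_cast e1
    linarith
  have hsum' : ((A' ∩ T).card : ℝ) + (B' ∩ T).card ≤ (A ∩ T).card := by
    have e1 : (A' ∩ T).card + (B' ∩ T).card ≤ (A ∩ T).card := by
      rw [← Finset.card_union_of_disjoint
        (h2.mono Finset.inter_subset_left Finset.inter_subset_left),
        ← Finset.union_inter_distrib_right]
      exact Finset.card_le_card
        (Finset.inter_subset_inter_right (Finset.union_subset hA' hB'))
    exact_mod_cast e1
  have hScard : (((S ∪ (S' \ B)).card : ℕ) : ℝ) ≤ s + c := by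
    have e1 : (S ∪ (S' \ B)).card ≤ S.card + S'.card :=
      (Finset.card_union_le _ _).trans
        (Nat.add_le_add_left (Finset.card_le_card Finset.sdiff_subset) _)
    have e2 : (((S ∪ (S' \ B)).card : ℕ) : ℝ) ≤ S.card + S'.card := by exact_mod_cast e1
    linarith
  have hmem : ∀ x, (x ∈ A ∨ x ∈ B) ↔ (x ∈ W ∧ x ∉ S) := fun x => by
    rw [← Finset.mem_union, g1, Finset.mem_sdiff]
  have hmem' : ∀ x, (x ∈ A' ∨ x ∈ B') ↔ (x ∈ A ∧ x ∉ S') := fun x => by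
    rw [← Finset.mem_union, h1, Finset.mem_sdiff]
  have hdAB : ∀ x, x ∈ A → x ∉ B := fun x h => Finset.disjoint_left.1 g2 h
  have hcount : ∀ P : Finset V, (((P ∪ B) ∩ T).card : ℝ) ≤ (P ∩ T).card + (B ∩ T).card := by
    intro P
    rw [Finset.union_inter_distrib_right]
    exact_mod_cast Finset.card_union_le _ _
  rcases le_or_gt ((A' ∩ T).card : ℝ) (τ / 3) with hlight | hlight
  · refine ⟨A' ∪ B, S ∪ (S' \ B), B', ⟨?_, ?_, ?_⟩, ?_, h5, hScard⟩
    · ext x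
      have m1 := hmem x
      have m2 := hmem' x
      have m3 := hdAB x
      simp only [Finset.mem_union, Finset.mem_sdiff]
      tauto
    · exact Finset.disjoint_union_left.2 ⟨h2, (g2.mono_left hB').symm⟩
    · intro a ha b hb hab
      rcases Finset.mem_union.1 ha with ha | ha
      · exact h3 a ha b hb hab
      · exact g3 b (hB' hb) a ha hab.symm
    · linarith [hcount A']
  · refine ⟨A', S ∪ (S' \ B), B' ∪ B, ⟨?_, ?_, ?_⟩, h4, ?_, hScard⟩
    · ext x
      have m1 := hmem x
      have m2 := hmem' x
      have m3 := hdAB x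
      simp only [Finset.mem_union, Finset.mem_sdiff]
      tauto
    · exact Finset.disjoint_union_right.2 ⟨h2, g2.mono_left hA'⟩
    · intro a ha b hb hab
      rcases Finset.mem_union.1 hb with hb | hb
      · exact h3 a ha b hb hab
      · exact g3 a (hA' ha) b hb hab
    · linarith [hcount B']

/-- Separating the heavy side of a balanced separation again. -/
theorem HasWeightedSeparation.step {V : Type*} [DecidableEq V] {G : SimpleGraph V}
    {T W A S B : Finset V} {τ s c : ℝ} (h : IsSeparation G W A S B) (hS : (S.card : ℝ) ≤ s)
    (hT : ((W ∩ T).card : ℝ) ≤ τ) (hc : 0 ≤ c)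
    (hA : HasWeightedSeparation G T τ A c) (hB : HasWeightedSeparation G T τ B c) :
    HasWeightedSeparation G T τ W (s + c) := by
  rcases lt_or_ge (2 * τ / 3) ((A ∩ T).card : ℝ) with hA' | hA'
  · exact of_heavy_side h hS hT hA' hA
  rcases lt_or_ge (2 * τ / 3) ((B ∩ T).card : ℝ) with hB' | hB'
  · exact of_heavy_side h.symm hS hT hB' hB
  exact ⟨A, S, B, h, hA', hB', by linarith⟩

theorem IsSeparation.left_subset {V : Type*} [DecidableEq V] {G : SimpleGraph V}
    {W A S B : Finset V} (h : IsSeparation G W A S B) : A ⊆ W := fun _ hx =>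
  (Finset.mem_sdiff.1 (h.1 ▸ Finset.mem_union_left B hx)).1

/-- Balanced separations of order `C n ^ α` give weighted separations of order `O(n ^ α)`: the
orders of the successive separations of the heavy side form a geometric series. -/
theorem hasWeightedSeparation_of_pow {V : Type} [DecidableEq V] {𝒢 : Set FinGraph}
    {G : SimpleGraph V} (hG : ∀ H : FinGraph, Nonempty (H.2 ↪g G) → H ∈ 𝒢)
    {C α : ℝ} (hα : 0 < α) (hC : 0 ≤ C) (hs : ∀ n : ℕ, (classSep 𝒢 n : ℝ) ≤ C * (n : ℝ) ^ α)
    {T : Finset V} {τ : ℝ} (W : Finset V) (hT : ((W ∩ T).card : ℝ) ≤ τ) :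
    HasWeightedSeparation G T τ W (C / (1 - (2 / 3) ^ α) * (W.card : ℝ) ^ α) := by
  set C' := C / (1 - (2 / 3 : ℝ) ^ α) with hC'
  have hq : 0 < 1 - (2 / 3 : ℝ) ^ α := by
    linarith [Real.rpow_lt_one (x := 2 / 3) (by norm_num) (by norm_num) hα]
  have hC'0 : 0 ≤ C' := div_nonneg hC hq.le
  have hCC : C + C' * (2 / 3) ^ α = C' := by
    have : C' * (1 - (2 / 3 : ℝ) ^ α) = C := by rw [hC']; field_simp
    linarith
  induction W using Finset.strongInduction with
  | H W ih =>
    have hτ : 0 ≤ τ := le_trans (by positivity) hT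
    rcases W.eq_empty_or_nonempty with rfl | hW
    · refine ⟨∅, ∅, ∅, ⟨by simp, by simp, by simp⟩, ?_, ?_, ?_⟩
      · simp; positivity
      · simp; positivity
      · simp; positivity
    obtain ⟨A, S, B, hsep, hA, hB, hS⟩ := exists_separation_of_class hG W
    have hW0 : (0 : ℝ) < W.card := by exact_mod_cast hW.card_pos
    have hside : ∀ A : Finset V, A ⊆ W → (A.card : ℝ) ≤ 2 * W.card / 3 →
        HasWeightedSeparation G T τ A (C' * (2 / 3 * W.card) ^ α) := by
      intro A hAW hA
      have hss : A ⊂ W := by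
        refine Finset.ssubset_iff_subset_ne.2 ⟨hAW, ?_⟩
        rintro rfl
        linarith
      refine (ih A hss (le_trans ?_ hT)).mono ?_
      · exact_mod_cast Finset.card_le_card (Finset.inter_subset_inter_right hAW)
      · exact mul_le_mul_of_nonneg_left
          (Real.rpow_le_rpow (by positivity) (by linarith) hα.le) hC'0
    have hfin := HasWeightedSeparation.step hsep
      (show (S.card : ℝ) ≤ C * (W.card : ℝ) ^ α from le_trans (by exact_mod_cast hS) (hs _)) hT
      (by positivity) (hside A hsep.left_subset hA) (hside B hsep.symm.left_subset hB)
    refine hfin.mono (le_of_eq ?_)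
    rw [Real.mul_rpow (by norm_num) hW0.le]
    linear_combination (W.card : ℝ) ^ α * hCC

theorem classSep_le {𝒢 : Set FinGraph} {n k : ℕ}
    (h : ∀ G ∈ 𝒢, G.1 ≤ n → sepNumber G.2 ≤ k) : classSep 𝒢 n ≤ k := by
  rcases Set.eq_empty_or_nonempty {k | ∃ G ∈ 𝒢, G.1 ≤ n ∧ sepNumber G.2 = k} with h0 | h0
  · unfold classSep
    rw [h0]
    simp
  · refine csSup_le h0 ?_
    rintro _ ⟨G, hG, hn, rfl⟩
    exact h G hG hn

theorem classSep_mono (𝒢 : Set FinGraph) {m n : ℕ} (h : m ≤ n) :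
    classSep 𝒢 m ≤ classSep 𝒢 n :=
  classSep_le fun G hG hm => le_csSup (bddAbove_classSep 𝒢 n) ⟨G, hG, hm.trans h, rfl⟩

/-- The first `I` separations are bounded by `s_𝒢(n)` each, the remaining ones by a geometric
series starting at size `(2 / 3) ^ I * n`. -/
theorem hasWeightedSeparation_of_steps {V : Type} [DecidableEq V] {𝒢 : Set FinGraph}
    {G : SimpleGraph V} (hG : ∀ H : FinGraph, Nonempty (H.2 ↪g G) → H ∈ 𝒢)
    {C α : ℝ} (hα : 0 < α) (hC : 0 ≤ C) (hs : ∀ n : ℕ, (classSep 𝒢 n : ℝ) ≤ C * (n : ℝ) ^ α)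
    {n : ℕ} {T : Finset V} {τ : ℝ} (I : ℕ) (W : Finset V) (hWn : W.card ≤ n)
    (hT : ((W ∩ T).card : ℝ) ≤ τ) :
    HasWeightedSeparation G T τ W
      (I * classSep 𝒢 n + C / (1 - (2 / 3) ^ α) * ((2 / 3) ^ I * (W.card : ℝ)) ^ α) := by
  have hq : 0 < 1 - (2 / 3 : ℝ) ^ α := by
    linarith [Real.rpow_lt_one (x := 2 / 3) (by norm_num) (by norm_num) hα]
  induction I generalizing W with
  | zero => simpa using hasWeightedSeparation_of_pow hG hα hC hs W hT
  | succ I ih =>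
    obtain ⟨A, S, B, hsep, hA, hB, hS⟩ := exists_separation_of_class hG W
    have hside : ∀ A : Finset V, A ⊆ W → (A.card : ℝ) ≤ 2 * W.card / 3 →
        HasWeightedSeparation G T τ A (I * classSep 𝒢 n +
          C / (1 - (2 / 3) ^ α) * ((2 / 3) ^ (I + 1) * (W.card : ℝ)) ^ α) := by
      intro A hAW hA
      refine (ih A ((Finset.card_le_card hAW).trans hWn) (le_trans ?_ hT)).mono ?_
      · exact_mod_cast Finset.card_le_card (Finset.inter_subset_inter_right hAW)
      · have h1 : (2 / 3 : ℝ) ^ I * A.card ≤ (2 / 3) ^ (I + 1) * (W.card : ℝ) := by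
          rw [pow_succ, mul_assoc]
          exact mul_le_mul_of_nonneg_left (by linarith) (by positivity)
        have h2 := Real.rpow_le_rpow (by positivity) h1 hα.le
        have h3 := mul_le_mul_of_nonneg_left h2 (div_nonneg hC hq.le)
        linarith
    have hfin := HasWeightedSeparation.step hsep
      (show (S.card : ℝ) ≤ classSep 𝒢 n by exact_mod_cast hS.trans (classSep_mono 𝒢 hWn)) hT
      (by have := div_nonneg hC hq.le; positivity) (hside A hsep.left_subset hA)
      (hside B hsep.symm.left_subset hB)
    refine hfin.mono (le_of_eq ?_)
    push_cast
    ring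

/-! ### Shallow minors and separations -/

theorem exists_walk_of_radius_le {V : Type*} {G : SimpleGraph V} {r : ℕ}
    (h : G.radius ≤ (r : ℕ∞)) : ∃ c, ∀ x, ∃ p : G.Walk c x, p.length ≤ r := by
  have hne : Nonempty V := by
    by_contra hV
    rw [not_nonempty_iff] at hV
    rw [SimpleGraph.radius_eq_top_of_isEmpty] at h
    exact absurd h (by simp)
  obtain ⟨c, hc⟩ := SimpleGraph.exists_eccent_eq_radius (G := G)
  refine ⟨c, fun x => ?_⟩
  have hd : G.edist c x ≤ r := SimpleGraph.edist_le_eccent.trans (hc.trans_le h)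
  obtain ⟨p, hp⟩ := SimpleGraph.exists_walk_of_edist_ne_top
    (ne_top_of_le_ne_top (ENat.natCast_ne_top r) hd)
  rw [← hp] at hd
  exact ⟨p, by exact_mod_cast hd⟩

/-- A branch set of radius at most `r` has a center that is joined to each of its vertices by a
connected subset with at most `r + 1` vertices. -/
theorem exists_center_of_radius_le {V : Type*} [DecidableEq V] {G : SimpleGraph V} {B : Set V}
    {r : ℕ} (h : (G.induce B).radius ≤ (r : ℕ∞)) :
    ∃ c ∈ B, ∀ x ∈ B, ∃ P : Finset V, c ∈ P ∧ x ∈ P ∧ (P : Set V) ⊆ B ∧ P.card ≤ r + 1 ∧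
      (G.induce (P : Set V)).Connected := by
  obtain ⟨c, hc⟩ := exists_walk_of_radius_le h
  refine ⟨c, c.2, fun x hx => ?_⟩
  obtain ⟨p, hp⟩ := hc ⟨x, hx⟩
  let p' := p.map (SimpleGraph.Embedding.induce (G := G) B).toHom
  refine ⟨p'.support.toFinset, ?_, ?_, ?_, ?_, ?_⟩
  · exact List.mem_toFinset.2 p'.start_mem_support
  · exact List.mem_toFinset.2 p'.end_mem_support
  · intro v hv
    rw [List.coe_toFinset, Set.mem_ofPred_eq, SimpleGraph.Walk.support_map, List.mem_map] at hv
    obtain ⟨w, -, rfl⟩ := hv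
    exact w.2
  · refine (List.toFinset_card_le _).trans ?_
    rw [SimpleGraph.Walk.length_support, SimpleGraph.Walk.length_map]
    exact Nat.succ_le_succ hp
  · rw [List.coe_toFinset]
    exact p'.connected_induce_support

/-- To realize only the edges in `F` of an `r`-shallow minor, `O(r |F|)` vertices suffice: a center
for each branch set, and for each edge in `F` a path from each of the two centers to the ends of a
corresponding edge of `G`. -/
theorem exists_small_minor_model {W V : Type*} [DecidableEq V] {r : ℕ} {H : SimpleGraph W}
    {G : SimpleGraph V} {B : W → Set V} (hrad : ∀ w, (G.induce (B w)).radius ≤ (r : ℕ∞))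
    (hdisj : ∀ u w, u ≠ w → Disjoint (B u) (B w))
    (hadj : ∀ u w, H.Adj u w → ∃ x ∈ B u, ∃ y ∈ B w, G.Adj x y)
    (U : Finset W) (F : Finset (W × W)) (hF : ∀ p ∈ F, (p.1 ∈ U ∧ p.2 ∈ U) ∧ H.Adj p.1 p.2) :
    ∃ (Z : Finset V) (B' : W → Set V), Z.card ≤ U.card + 2 * (r + 1) * F.card ∧
      (∀ u ∈ U, B' u ⊆ Z) ∧ (∀ u, (G.induce (B' u)).Connected) ∧
      (∀ u w, u ≠ w → Disjoint (B' u) (B' w)) ∧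
      ∀ p ∈ F, ∃ x ∈ B' p.1, ∃ y ∈ B' p.2, G.Adj x y := by
  classical
  choose c hcB hc using fun w => exists_center_of_radius_le (hrad w)
  have hQR : ∀ p : W × W, ∃ Q R : Finset V, p ∈ F →
      (c p.1 ∈ Q ∧ (Q : Set V) ⊆ B p.1 ∧ Q.card ≤ r + 1 ∧ (G.induce (Q : Set V)).Connected) ∧
      (c p.2 ∈ R ∧ (R : Set V) ⊆ B p.2 ∧ R.card ≤ r + 1 ∧ (G.induce (R : Set V)).Connected) ∧
      ∃ x ∈ Q, ∃ y ∈ R, G.Adj x y := by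
    intro p
    by_cases hp : p ∈ F
    · obtain ⟨x, hx, y, hy, hxy⟩ := hadj _ _ (hF p hp).2
      obtain ⟨Q, q1, q2, q3, q4, q5⟩ := hc _ x hx
      obtain ⟨R, r1, r2, r3, r4, r5⟩ := hc _ y hy
      exact ⟨Q, R, fun _ => ⟨⟨q1, q3, q4, q5⟩, ⟨r1, r3, r4, r5⟩, x, q2, y, r2, hxy⟩⟩
    · exact ⟨∅, ∅, fun h => absurd h hp⟩
  choose Q R hQR using hQR
  let S : W → Set (Set V) := fun u =>
    {s | s = {c u} ∨ (∃ p ∈ F, p.1 = u ∧ s = Q p) ∨ ∃ p ∈ F, p.2 = u ∧ s = R p}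
  have hSc : ∀ u, ∀ s ∈ S u, c u ∈ s ∧ s ⊆ B u ∧ (G.induce s).Connected := by
    rintro u s (rfl | ⟨p, hp, rfl, rfl⟩ | ⟨p, hp, rfl, rfl⟩)
    · refine ⟨rfl, by simpa using hcB u, ?_⟩
      exact ⟨SimpleGraph.Preconnected.of_subsingleton⟩
    · obtain ⟨⟨h1, h2, h3, h4⟩, -⟩ := hQR p hp
      exact ⟨h1, h2, h4⟩
    · obtain ⟨-, ⟨h1, h2, h3, h4⟩, -⟩ := hQR p hp
      exact ⟨h1, h2, h4⟩
  have hSB : ∀ u, ⋃₀ S u ⊆ B u := fun u => Set.sUnion_subset fun s hs => (hSc u s hs).2.1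
  refine ⟨U.image c ∪ F.biUnion fun p => Q p ∪ R p, fun u => ⋃₀ S u, ?_, ?_, ?_, ?_, ?_⟩
  · refine (Finset.card_union_le _ _).trans (Nat.add_le_add Finset.card_image_le ?_)
    rw [mul_comm]
    refine Finset.card_biUnion_le_card_mul _ _ _ fun p hp => ?_
    obtain ⟨⟨-, -, h1, -⟩, ⟨-, -, h2, -⟩, -⟩ := hQR p hp
    exact (Finset.card_union_le _ _).trans (by omega)
  · rintro u hu x ⟨s, (rfl | ⟨p, hp, rfl, rfl⟩ | ⟨p, hp, rfl, rfl⟩), hx⟩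
    · rw [Set.mem_singleton_iff] at hx
      subst hx
      exact Finset.mem_union_left _ (Finset.mem_image_of_mem c hu)
    · exact Finset.mem_union_right _ (Finset.mem_biUnion.2 ⟨p, hp, Finset.mem_union_left _ hx⟩)
    · exact Finset.mem_union_right _ (Finset.mem_biUnion.2 ⟨p, hp, Finset.mem_union_right _ hx⟩)
  · intro u
    exact SimpleGraph.induce_sUnion_connected_of_pairwise_not_disjoint ⟨{c u}, Or.inl rfl⟩
      (fun hs ht => ⟨c u, (hSc u _ hs).1, (hSc u _ ht).1⟩) (fun hs => (hSc u _ hs).2.2)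
  · intro u w huw
    exact (hdisj u w huw).mono (hSB u) (hSB w)
  · intro p hp
    obtain ⟨-, -, x, hx, y, hy, hxy⟩ := hQR p hp
    exact ⟨x, ⟨Q p, Or.inr (Or.inl ⟨p, hp, rfl, rfl⟩), hx⟩, y,
      ⟨R p, Or.inr (Or.inr ⟨p, hp, rfl, rfl⟩), hy⟩, hxy⟩

/-- A connected set that avoids `S` lies on one side of the separation. -/
theorem IsSeparation.subset_left_of_connected {V : Type*} [DecidableEq V] {G : SimpleGraph V}
    {W A S B : Finset V} (h : IsSeparation G W A S B) {P : Set V} (hP : (G.induce P).Connected)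
    (hPW : P ⊆ W) (hPS : ∀ x ∈ P, x ∉ S) {c : V} (hcP : c ∈ P) (hcA : c ∈ A) : P ⊆ A := by
  have key : ∀ (u v : P), (G.induce P).Walk u v → u.1 ∈ A → v.1 ∈ A := by
    intro u v p
    induction p with
    | nil => exact id
    | @cons u v w huv p ih =>
      intro hu
      refine ih ?_
      have hv : v.1 ∈ A ∪ B := by
        rw [h.1, Finset.mem_sdiff]
        exact ⟨hPW v.2, hPS _ v.2⟩
      exact (Finset.mem_union.1 hv).resolve_right fun hvB => h.2.2 _ hu _ hvB huv
  intro x hx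
  obtain ⟨p⟩ := hP.preconnected ⟨c, hcP⟩ ⟨x, hx⟩
  exact key _ _ p hcA

/-- Separations of a graph, with weights on one vertex of each branch set, induce separations of
its minors. -/
theorem exists_cut_of_minor_model {W V : Type*} [DecidableEq W] [DecidableEq V]
    {G : SimpleGraph V} {Z : Finset V} {B : W → Set V} {U : Finset W} {F : Finset (W × W)}
    (hBZ : ∀ u ∈ U, B u ⊆ Z) (hconn : ∀ u, (G.induce (B u)).Connected)
    (hdisj : ∀ u w, u ≠ w → Disjoint (B u) (B w))
    (hF : ∀ p ∈ F, ∃ x ∈ B p.1, ∃ y ∈ B p.2, G.Adj x y) {s : ℝ}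
    (hsep : ∀ T : Finset V, ∀ τ : ℝ, ((Z ∩ T).card : ℝ) ≤ τ → HasWeightedSeparation G T τ Z s) :
    ∃ A ⊆ U, ∃ A' ⊆ U, Disjoint A A' ∧ (A.card : ℝ) ≤ 2 * U.card / 3 ∧
      (A'.card : ℝ) ≤ 2 * U.card / 3 ∧ ((U \ (A ∪ A')).card : ℝ) ≤ s ∧
      ∀ p ∈ F, ¬ ((p.1 ∈ A ∧ p.2 ∈ A') ∨ (p.1 ∈ A' ∧ p.2 ∈ A)) := by
  classical
  have hne : ∀ u, ∃ c, c ∈ B u := fun u => by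
    obtain ⟨⟨c, hc⟩⟩ := (hconn u).nonempty
    exact ⟨c, hc⟩
  choose c hc using hne
  have hinj : ∀ f : W → V, ∀ P : Finset W, (∀ u ∈ P, f u ∈ B u) → Set.InjOn f P := by
    intro f P hf u hu w hw huw
    by_contra hne
    exact Set.disjoint_left.1 (hdisj u w hne) (hf u hu) (huw ▸ hf w hw)
  obtain ⟨A, S, A', hAS, hA, hA', hS⟩ := hsep (U.image c) U.card (by
    exact_mod_cast (Finset.card_le_card Finset.inter_subset_right).trans Finset.card_image_le)
  have hside : ∀ D : Finset V, ((D ∩ U.image c).card : ℝ) ≤ 2 * U.card / 3 →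
      ((U.filter fun u => (∀ x ∈ B u, x ∉ S) ∧ c u ∈ D).card : ℝ) ≤ 2 * U.card / 3 := by
    intro D hD
    refine le_trans ?_ hD
    norm_cast
    refine Finset.card_le_card_of_injOn c ?_ (hinj c _ fun u _ => hc u)
    intro u hu
    obtain ⟨h1, -, h2⟩ := Finset.mem_filter.1 hu
    exact Finset.mem_inter.2 ⟨h2, Finset.mem_image_of_mem c h1⟩
  refine ⟨U.filter fun u => (∀ x ∈ B u, x ∉ S) ∧ c u ∈ A, Finset.filter_subset _ _,
    U.filter fun u => (∀ x ∈ B u, x ∉ S) ∧ c u ∈ A', Finset.filter_subset _ _,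
    ?_, hside A hA, hside A' hA', ?_, ?_⟩
  · rw [Finset.disjoint_left]
    intro u hu hu'
    exact Finset.disjoint_left.1 hAS.2.1 (Finset.mem_filter.1 hu).2.2 (Finset.mem_filter.1 hu').2.2
  · refine le_trans ?_ hS
    have hhit : ∀ u, ∃ x, u ∈ U \ ((U.filter fun u => (∀ x ∈ B u, x ∉ S) ∧ c u ∈ A) ∪
        (U.filter fun u => (∀ x ∈ B u, x ∉ S) ∧ c u ∈ A')) → x ∈ B u ∧ x ∈ S := by
      intro u
      by_cases h : ∃ x ∈ B u, x ∈ S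
      · obtain ⟨x, hx⟩ := h
        exact ⟨x, fun _ => hx⟩
      · refine ⟨c u, fun hu => ?_⟩
        push Not at h
        simp only [Finset.mem_sdiff, Finset.mem_union, Finset.mem_filter, not_or] at hu
        obtain ⟨hu, h1, h2⟩ := hu
        have : c u ∈ A ∪ A' := by
          rw [hAS.1, Finset.mem_sdiff]
          exact ⟨hBZ u hu (hc u), h _ (hc u)⟩
        rcases Finset.mem_union.1 this with h' | h'
        · exact absurd ⟨hu, h, h'⟩ h1
        · exact absurd ⟨hu, h, h'⟩ h2
    choose f hf using hhit
    norm_cast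
    exact Finset.card_le_card_of_injOn f (fun u hu => (hf u hu).2)
      (hinj f _ fun u hu => (hf u hu).1)
  · have hno : ∀ u w, u ∈ (U.filter fun u => (∀ x ∈ B u, x ∉ S) ∧ c u ∈ A) →
        w ∈ (U.filter fun u => (∀ x ∈ B u, x ∉ S) ∧ c u ∈ A') →
        ∀ x ∈ B u, ∀ y ∈ B w, ¬ G.Adj x y := by
      intro u w hu hw x hx y hy
      obtain ⟨hu1, hu2, hu3⟩ := Finset.mem_filter.1 hu
      obtain ⟨hw1, hw2, hw3⟩ := Finset.mem_filter.1 hw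
      exact hAS.2.2 x (hAS.subset_left_of_connected (hconn u) (hBZ u hu1) hu2 (hc u) hu3 hx) y
        (hAS.symm.subset_left_of_connected (hconn w) (hBZ w hw1) hw2 (hc w) hw3 hy)
    rintro p hp (⟨h1, h2⟩ | ⟨h1, h2⟩)
    · obtain ⟨x, hx, y, hy, hxy⟩ := hF p hp
      exact hno _ _ h1 h2 x hx y hy hxy
    · obtain ⟨x, hx, y, hy, hxy⟩ := hF p hp
      exact hno _ _ h2 h1 y hy x hx hxy.symm

/-! ### Sublinear separators bound the density of shallow minors -/

theorem density_eq_ofReal {H : FinGraph} (hH : H.1 ≠ 0) :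
    density H = ENNReal.ofReal ((H.2.edgeSet.ncard : ℝ) / H.1) := by
  rw [density, ENNReal.ofReal_div_of_pos (by exact_mod_cast Nat.pos_of_ne_zero hH),
    ENNReal.ofReal_natCast, ENNReal.ofReal_natCast]

/-- A sparse expander on `k` vertices in an `r`-shallow minor would have a cut of order
`O((r k ^ (1 + δ)) ^ α)`; this forces `k = O(r ^ (α / (1 - δ - α (1 + δ))))`, and the density is
`O(k)`. -/
theorem exists_classNabla_le {𝒢 : Set FinGraph} (h𝒢 : IsHereditary 𝒢) {C α δ : ℝ} (hα : 0 < α)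
    (hδ : 0 < δ) (hγ : 0 < 1 - δ - α * (1 + δ)) (hC : 0 ≤ C)
    (hs : ∀ n : ℕ, (classSep 𝒢 n : ℝ) ≤ C * (n : ℝ) ^ α) :
    ∃ C₂ : ℝ, ∀ r : ℕ, 1 ≤ r →
      classNabla 𝒢 r ≤ ENNReal.ofReal (C₂ * (r : ℝ) ^ (α / (1 - δ - α * (1 + δ)))) := by
  obtain ⟨D, hD, hexp⟩ := exists_sparse_expander hδ
  set γ := 1 - δ - α * (1 + δ) with hγdef
  have hq : 0 < 1 - (2 / 3 : ℝ) ^ α := by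
    linarith [Real.rpow_lt_one (x := 2 / 3) (by norm_num) (by norm_num) hα]
  set C' := C / (1 - (2 / 3 : ℝ) ^ α) with hC'
  have hC'0 : 0 ≤ C' := div_nonneg hC hq.le
  -- the sparse expander is realized on at most `k + 2 (r + 1) * 3 k ^ (1 + δ) ≤ 13 r k ^ (1 + δ)`
  -- vertices
  set M := C' * 13 ^ α with hM
  have hM0 : 0 ≤ M := by positivity
  refine ⟨D * (1 + M ^ (1 / γ)), fun r hr => ?_⟩
  have hr1 : (1 : ℝ) ≤ r := by exact_mod_cast hr
  have hr0 : (0 : ℝ) < r := by linarith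
  have hrp : 1 ≤ (r : ℝ) ^ (α / γ) := Real.one_le_rpow hr1 (by positivity)
  have hMp : 0 ≤ M ^ (1 / γ) := by positivity
  refine iSup₂_le fun G hG => iSup₂_le fun H hH => ?_
  by_cases hH0 : H.1 = 0
  · have : H.2.edgeSet.ncard = 0 := by
      have he : IsEmpty (Fin H.1) := by rw [hH0]; infer_instance
      rw [Set.ncard_eq_zero, Set.eq_empty_iff_forall_notMem]
      intro e
      induction e using Sym2.ind with
      | _ x y => exact he.elim x
    simp [density, this]
  rw [density_eq_ofReal hH0]
  refine ENNReal.ofReal_le_ofReal ?_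
  have : Nonempty (Fin H.1) := ⟨⟨0, Nat.pos_of_ne_zero hH0⟩⟩
  have hcases := hexp H.2
  rw [Fintype.card_fin] at hcases
  rcases hcases with h1 | ⟨U, F, hU, hdens, hFc, hF, hcut⟩
  · refine h1.trans ?_
    rw [mul_assoc]
    exact le_mul_of_one_le_right hD.le (by nlinarith)
  set k : ℝ := (U.card : ℝ) with hk
  have hk1 : 1 ≤ k := by rw [hk]; exact_mod_cast hU.card_pos
  have hk0 : 0 < k := by linarith
  have hkK : k ≤ M ^ (1 / γ) * (r : ℝ) ^ (α / γ) := by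
    by_contra! hlt
    obtain ⟨B, hrad, hdisj, hadj⟩ := hH
    obtain ⟨Z, B', hZ, hBZ, hconn, hdisj', hF'⟩ :=
      exists_small_minor_model hrad hdisj hadj U F hF
    have hMk : M * (r : ℝ) ^ α ≤ k ^ γ := by
      have h2 := Real.rpow_le_rpow (by positivity) hlt.le hγ.le
      rw [Real.mul_rpow hMp (by positivity), ← Real.rpow_mul hM0, ← Real.rpow_mul hr0.le] at h2
      rwa [one_div_mul_cancel hγ.ne', div_mul_cancel₀ _ hγ.ne', Real.rpow_one] at h2
    have hkp : k ≤ k ^ (1 + δ) := by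
      conv_lhs => rw [← Real.rpow_one k]
      exact Real.rpow_le_rpow_of_exponent_le hk1 (by linarith)
    have hZ' : (Z.card : ℝ) ≤ 13 * r * k ^ (1 + δ) := by
      have h3 : (Z.card : ℝ) ≤ k + 2 * (r + 1) * F.card := by
        rw [hk]; exact_mod_cast hZ
      have h4 : 2 * ((r : ℝ) + 1) * F.card ≤ 4 * r * (3 * k ^ (1 + δ)) :=
        mul_le_mul (by linarith) hFc (by positivity) (by positivity)
      have h5 : k ^ (1 + δ) ≤ r * k ^ (1 + δ) := le_mul_of_one_le_left (by positivity) hr1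
      linarith
    have hord : C' * (Z.card : ℝ) ^ α ≤ k ^ (1 - δ) := by
      calc C' * (Z.card : ℝ) ^ α ≤ C' * (13 * r * k ^ (1 + δ)) ^ α :=
            mul_le_mul_of_nonneg_left (Real.rpow_le_rpow (by positivity) hZ' hα.le) hC'0
        _ = M * (r : ℝ) ^ α * k ^ ((1 + δ) * α) := by
            rw [Real.mul_rpow (by positivity) (by positivity),
              Real.mul_rpow (by norm_num) hr0.le, ← Real.rpow_mul hk0.le, hM]
            ring
        _ ≤ k ^ γ * k ^ ((1 + δ) * α) := mul_le_mul_of_nonneg_right hMk (by positivity)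
        _ = k ^ (1 - δ) := by
            rw [← Real.rpow_add hk0, hγdef]
            congr 1
            ring
    obtain ⟨A, hA, A', hA', hAA, h6, h7, h8, h9⟩ := exists_cut_of_minor_model hBZ hconn hdisj' hF'
      (s := C' * (Z.card : ℝ) ^ α)
      (fun T τ hT => hasWeightedSeparation_of_pow (h𝒢 G hG) hα hC hs Z hT)
    obtain ⟨p, hp, hp'⟩ := hcut A hA A' hA' hAA h6 h7 (h8.trans hord)
    exact h9 p hp hp'
  calc (H.2.edgeSet.ncard : ℝ) / H.1 ≤ D * k := hdens
    _ ≤ D * (M ^ (1 / γ) * (r : ℝ) ^ (α / γ)) := mul_le_mul_of_nonneg_left hkK hD.le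
    _ ≤ D * (1 + M ^ (1 / γ)) * (r : ℝ) ^ (α / γ) := by
        rw [mul_assoc]
        exact mul_le_mul_of_nonneg_left
          (mul_le_mul_of_nonneg_right (by linarith) (by linarith)) hD.le

/-- An asymptotic upper bound on `s_𝒢` with a positive exponent holds for all `n`. -/
theorem exists_classSep_le {𝒢 : Set FinGraph} {α β : ℝ} (hα : 0 < α) (hβα : β ≤ α)
    (h : (fun n : ℕ => (classSep 𝒢 n : ℝ)) =O[atTop] fun n : ℕ => (n : ℝ) ^ β) :
    ∃ C : ℝ, 0 ≤ C ∧ ∀ n : ℕ, (classSep 𝒢 n : ℝ) ≤ C * (n : ℝ) ^ α := by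
  obtain ⟨c, hc⟩ := h.bound
  obtain ⟨N, hN⟩ := eventually_atTop.1 hc
  have hle : ∀ n, classSep 𝒢 n ≤ n := fun n =>
    classSep_le fun G _ hn => (sepNumber_le_card G.2).trans (by simpa using hn)
  refine ⟨max c N, le_max_of_le_right (Nat.cast_nonneg _), fun n => ?_⟩
  rcases Nat.eq_zero_or_pos n with rfl | hn
  · have : classSep 𝒢 0 = 0 := Nat.le_zero.1 (hle 0)
    rw [this]
    simp [hα.ne']
  have hn1 : (1 : ℝ) ≤ n := by exact_mod_cast hn
  have hp1 : 1 ≤ (n : ℝ) ^ α := Real.one_le_rpow hn1 hα.le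
  rcases le_or_gt N n with hNn | hNn
  · have h1 := hN n hNn
    rw [Real.norm_of_nonneg (by positivity), Real.norm_of_nonneg (by positivity)] at h1
    refine h1.trans ?_
    have h2 : (n : ℝ) ^ β ≤ (n : ℝ) ^ α := Real.rpow_le_rpow_of_exponent_le hn1 hβα
    calc c * (n : ℝ) ^ β ≤ max c N * (n : ℝ) ^ β :=
          mul_le_mul_of_nonneg_right (le_max_left _ _) (by positivity)
      _ ≤ max c N * (n : ℝ) ^ α :=
          mul_le_mul_of_nonneg_left h2 (le_max_of_le_right (Nat.cast_nonneg _))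
  · calc (classSep 𝒢 n : ℝ) ≤ n := by exact_mod_cast hle n
      _ ≤ max c N := le_max_of_le_right (by exact_mod_cast hNn.le)
      _ ≤ max c N * (n : ℝ) ^ α :=
          le_mul_of_one_le_right (le_max_of_le_right (Nat.cast_nonneg _)) hp1

/-- Every exponent above `1 / ε - 1` bounds the expansion of hereditary classes with
`s_𝒢(n) = Θ(n ^ (1 - ε))`. Working with an exponent `α` slightly above `1 - ε` (which is positive
also for `ε = 1`) and a small `δ` costs less than the distance from `B` to `1 / ε - 1`. -/
theorem nablaIsBigO_of_hasSepExponent {ε B : ℝ} (hε0 : 0 < ε) (hε1 : ε ≤ 1) (hB : 1 / ε - 1 < B)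
    {𝒢 : Set FinGraph} (h𝒢 : IsHereditary 𝒢) (hs : HasSepExponent 𝒢 ε) : NablaIsBigO 𝒢 B := by
  have hB0 : 0 < B := by
    have : 1 ≤ 1 / ε := (one_le_div hε0).2 hε1
    linarith
  have hBε : 1 - ε < B / (1 + B) := by
    rw [lt_div_iff₀ (by linarith)]
    have : 1 < ε * (1 + B) := by
      have := (div_lt_iff₀ hε0).1 (show 1 / ε < 1 + B by linarith)
      linarith
    linarith
  obtain ⟨α, hα1, hα2⟩ := exists_between hBε
  have hα0 : 0 < α := by linarith
  have hαB : α * (1 + B) < B := (lt_div_iff₀ (by linarith)).1 hα2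
  -- `δ` is chosen so that `α = B (1 - δ - α (1 + δ))`
  set δ := (B - α * (1 + B)) / (B * (1 + α)) with hδdef
  have hδ : 0 < δ := div_pos (by linarith) (by positivity)
  have hδB : B * (1 - δ - α * (1 + δ)) = α := by
    have : δ * (B * (1 + α)) = B - α * (1 + B) := by rw [hδdef]; field_simp
    linarith
  have hγ : 0 < 1 - δ - α * (1 + δ) := by
    by_contra! h
    nlinarith
  obtain ⟨C, hC, hsC⟩ := exists_classSep_le hα0 hα1.le hs.1
  obtain ⟨C₂, hC₂⟩ := exists_classNabla_le h𝒢 hα0 hδ hγ hC hsC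
  refine ⟨C₂, eventually_atTop.2 ⟨1, fun r hr => ?_⟩⟩
  have := hC₂ r hr
  rwa [show α / (1 - δ - α * (1 + δ)) = B by rw [div_eq_iff hγ.ne', hδB]] at this

/-! ### Subdivisions and their shallow minors -/

section Subdivision

variable {V : Type} [LinearOrder V] {G : SimpleGraph V} {t : ℕ}

@[simp]
theorem subdivisionPath_zero (e : OrientedEdge G) : subdivisionPath t e 0 = Sum.inl e.1.1 := rfl

theorem subdivisionPath_succ_of_lt (e : OrientedEdge G) {i : ℕ} (h : i < t) :
    subdivisionPath t e (i + 1) = Sum.inr (e, ⟨i, h⟩) := by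
  simp [subdivisionPath, h]

theorem subdivisionPath_last (e : OrientedEdge G) :
    subdivisionPath t e (t + 1) = Sum.inl e.1.2 := by
  simp [subdivisionPath]

theorem subdivide_adj_path (e : OrientedEdge G) {i : ℕ} (hi : i ≤ t) :
    (subdivide G t).Adj (subdivisionPath t e i) (subdivisionPath t e (i + 1)) := by
  refine (SimpleGraph.fromRel_adj _ _ _).2 ⟨?_, Or.inl ⟨e, i, hi, rfl, rfl⟩⟩
  rcases Nat.eq_zero_or_pos i with rfl | hi0
  · rcases Nat.eq_zero_or_pos t with rfl | ht
    · rw [subdivisionPath_last]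
      simp only [subdivisionPath_zero, ne_eq, Sum.inl.injEq]
      exact e.2.1.ne
    · rw [subdivisionPath_succ_of_lt e ht]
      simp
  · obtain ⟨j, rfl⟩ : ∃ j, i = j + 1 := ⟨i - 1, by omega⟩
    rw [subdivisionPath_succ_of_lt e (by omega : j < t)]
    rcases Nat.lt_or_ge (j + 1) t with h | h
    · rw [subdivisionPath_succ_of_lt e h]
      simp
    · obtain rfl : t = j + 1 := by omega
      rw [subdivisionPath_last]
      simp

/-- The vertex `v` of `G` together with the new vertices on the edges of which `v` is the smaller
end. -/
def subdivisionStar (G : SimpleGraph V) (t : ℕ) (v : V) : Set (V ⊕ (OrientedEdge G × Fin t)) :=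
  {x | x = Sum.inl v ∨ ∃ (e : OrientedEdge G) (i : Fin t), e.1.1 = v ∧ x = Sum.inr (e, i)}

theorem subdivisionPath_mem_star (e : OrientedEdge G) {i : ℕ} (hi : i ≤ t) :
    subdivisionPath t e i ∈ subdivisionStar G t e.1.1 := by
  rcases Nat.eq_zero_or_pos i with rfl | hi0
  · exact Or.inl rfl
  · obtain ⟨j, rfl⟩ : ∃ j, i = j + 1 := ⟨i - 1, by omega⟩
    exact Or.inr ⟨e, ⟨j, by omega⟩, rfl, subdivisionPath_succ_of_lt e (by omega)⟩

theorem radius_subdivisionStar_le (v : V) :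
    ((subdivide G t).induce (subdivisionStar G t v)).radius ≤ (t : ℕ∞) := by
  set G' := (subdivide G t).induce (subdivisionStar G t v)
  have hc : Sum.inl v ∈ subdivisionStar G t v := Or.inl rfl
  have key : ∀ e : OrientedEdge G, ∀ hev : e.1.1 = v, ∀ i, ∀ hi : i ≤ t,
      G'.edist ⟨Sum.inl v, hc⟩
        ⟨subdivisionPath t e i, hev ▸ subdivisionPath_mem_star e hi⟩ ≤ i := by
    intro e hev i
    induction i with
    | zero =>
      intro hi
      subst hev
      simp
    | succ i ih =>
      intro hi
      refine (SimpleGraph.edist_triangle (v := ⟨subdivisionPath t e i,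
        hev ▸ subdivisionPath_mem_star e (by omega)⟩)).trans ?_
      have hadj : G'.Adj
          ⟨subdivisionPath t e i, hev ▸ subdivisionPath_mem_star e (by omega)⟩
          ⟨subdivisionPath t e (i + 1), hev ▸ subdivisionPath_mem_star e hi⟩ :=
        subdivide_adj_path e (by omega)
      rw [SimpleGraph.edist_eq_one_iff_adj.2 hadj]
      push_cast
      exact add_le_add (ih (by omega)) le_rfl
  refine (SimpleGraph.radius_le_eccent (u := ⟨Sum.inl v, hc⟩)).trans ?_
  rw [SimpleGraph.eccent_le_iff]
  rintro ⟨x, rfl | ⟨e, i, hev, rfl⟩⟩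
  · simp
  · have h := key e hev (i + 1) (by omega)
    simp only [subdivisionPath_succ_of_lt e i.2] at h
    exact h.trans (by exact_mod_cast i.2)

theorem disjoint_subdivisionStar {u w : V} (h : u ≠ w) :
    Disjoint (subdivisionStar G t u) (subdivisionStar G t w) := by
  rw [Set.disjoint_left]
  rintro x (rfl | ⟨e, i, rfl, rfl⟩) (h' | ⟨e', i', h', h''⟩)
  · exact h (Sum.inl.inj h')
  · exact absurd h'' (by simp)
  · exact absurd h' (by simp)
  · obtain rfl : e = e' := congrArg Prod.fst (Sum.inr.inj h'')
    exact h h'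

theorem exists_adj_subdivisionStar {u w : V} (h : G.Adj u w) :
    ∃ x ∈ subdivisionStar G t u, ∃ y ∈ subdivisionStar G t w, (subdivide G t).Adj x y := by
  have key : ∀ e : OrientedEdge G, ∃ x ∈ subdivisionStar G t e.1.1,
      ∃ y ∈ subdivisionStar G t e.1.2, (subdivide G t).Adj x y := fun e =>
    ⟨_, subdivisionPath_mem_star e le_rfl, _, Or.inl (subdivisionPath_last e),
      subdivide_adj_path e le_rfl⟩
  rcases lt_or_gt_of_ne h.ne with hlt | hlt
  · exact key ⟨(u, w), hlt, h⟩
  · obtain ⟨x, hx, y, hy, hxy⟩ := key ⟨(w, u), hlt, h.symm⟩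
    exact ⟨y, hy, x, hx, hxy.symm⟩

/-- Contracting the stars recovers the graph from its subdivision. -/
theorem isShallowMinor_subdivide {r : ℕ} (htr : t ≤ r) : IsShallowMinor r G (subdivide G t) :=
  ⟨subdivisionStar G t,
    fun v => (radius_subdivisionStar_le v).trans (by exact_mod_cast htr),
    fun _ _ h => disjoint_subdivisionStar h, fun _ _ h => exists_adj_subdivisionStar h⟩

/-! ### Small separators in subdivisions -/

/-- All vertices of the path that replaces `e` lie in `Y`. -/
def IsFullEdge (Y : Set (V ⊕ (OrientedEdge G × Fin t))) (e : OrientedEdge G) : Prop :=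
  Sum.inl e.1.1 ∈ Y ∧ Sum.inl e.1.2 ∈ Y ∧ ∀ i, Sum.inr (e, i) ∈ Y

/-- If `Y` contains no full edge, this names the component of a vertex in the subgraph induced
by `Y`, cut additionally at the position `cut e` of each edge `e`: the vertex of `G` to which it is
joined in `Y` along its edge, or else the edge and the side of the cut. -/
noncomputable def componentLabel (Y : Set (V ⊕ (OrientedEdge G × Fin t)))
    (cut : OrientedEdge G → ℕ) :
    V ⊕ (OrientedEdge G × Fin t) → V ⊕ (OrientedEdge G × Bool)
  | Sum.inl v => Sum.inl v
  | Sum.inr (e, i) =>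
    open scoped Classical in
    if Sum.inl e.1.1 ∈ Y ∧ ∀ j ≤ i, Sum.inr (e, j) ∈ Y then Sum.inl e.1.1
    else if Sum.inl e.1.2 ∈ Y ∧ ∀ j ≥ i, Sum.inr (e, j) ∈ Y then Sum.inl e.1.2
    else Sum.inr (e, decide ((i : ℕ) < cut e))

variable {Y : Set (V ⊕ (OrientedEdge G × Fin t))} {cut : OrientedEdge G → ℕ}

theorem componentLabel_path_eq (ht : 0 < t) (hY : ∀ e, ¬ IsFullEdge Y e)
    (hcut : ∀ e i, Sum.inr (e, i) ∈ Y → (i : ℕ) ≠ cut e) (e : OrientedEdge G) {i : ℕ} (hi : i ≤ t)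
    (h1 : subdivisionPath t e i ∈ Y) (h2 : subdivisionPath t e (i + 1) ∈ Y) :
    componentLabel Y cut (subdivisionPath t e i) =
      componentLabel Y cut (subdivisionPath t e (i + 1)) := by
  rcases Nat.eq_zero_or_pos i with rfl | hi0
  · rw [subdivisionPath_succ_of_lt e ht] at h2 ⊢
    rw [subdivisionPath_zero] at h1 ⊢
    have : ∀ j ≤ (⟨0, ht⟩ : Fin t), Sum.inr (e, j) ∈ Y := by
      intro j hj
      obtain rfl : j = ⟨0, ht⟩ := Fin.ext (Nat.le_zero.1 (Fin.le_def.1 hj))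
      exact h2
    simp only [componentLabel]
    rw [if_pos ⟨h1, this⟩]
  obtain ⟨j, rfl⟩ : ∃ j, i = j + 1 := ⟨i - 1, by omega⟩
  have hj : j < t := by omega
  rw [subdivisionPath_succ_of_lt e hj] at h1 ⊢
  rcases Nat.lt_or_ge (j + 1) t with h | h
  · rw [subdivisionPath_succ_of_lt e h] at h2 ⊢
    have e1 : (∀ k ≤ (⟨j, hj⟩ : Fin t), (Sum.inr (e, k) : V ⊕ (OrientedEdge G × Fin t)) ∈ Y) ↔
        ∀ k ≤ (⟨j + 1, h⟩ : Fin t), Sum.inr (e, k) ∈ Y := by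
      constructor
      · intro hk k hkj
        rcases eq_or_ne k ⟨j + 1, h⟩ with rfl | hne
        · exact h2
        · refine hk k ?_
          have a1 := Fin.le_def.1 hkj
          have a2 := Fin.val_ne_of_ne hne
          rw [Fin.le_def]
          simp only at a1 a2 ⊢
          omega
      · intro hk k hkj
        refine hk k (Fin.le_def.2 ?_)
        have a1 := Fin.le_def.1 hkj
        simp only at a1 ⊢
        omega
    have e2 : (∀ k ≥ (⟨j, hj⟩ : Fin t), (Sum.inr (e, k) : V ⊕ (OrientedEdge G × Fin t)) ∈ Y) ↔
        ∀ k ≥ (⟨j + 1, h⟩ : Fin t), Sum.inr (e, k) ∈ Y := by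
      constructor
      · intro hk k hkj
        refine hk k (Fin.le_def.2 ?_)
        have a1 := Fin.le_def.1 hkj
        simp only at a1 ⊢
        omega
      · intro hk k hkj
        rcases eq_or_ne k ⟨j, hj⟩ with rfl | hne
        · exact h1
        · refine hk k ?_
          have a1 := Fin.le_def.1 hkj
          have a2 := Fin.val_ne_of_ne hne
          rw [ge_iff_le, Fin.le_def]
          simp only at a1 a2 ⊢
          omega
    have e3 : decide (j < cut e) = decide (j + 1 < cut e) := by
      have b1 := hcut e _ h1
      have b2 := hcut e _ h2
      simp only at b1 b2
      rw [decide_eq_decide]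
      omega
    simp only [componentLabel]
    rw [e3]
    classical
    exact if_congr (and_congr_right fun _ => e1) rfl
      (if_congr (and_congr_right fun _ => e2) rfl rfl)
  · obtain rfl : t = j + 1 := by omega
    rw [subdivisionPath_last] at h2 ⊢
    have hr : ∀ k ≥ (⟨j, hj⟩ : Fin (j + 1)), Sum.inr (e, k) ∈ Y := by
      intro k hk
      obtain rfl : k = ⟨j, hj⟩ := by
        have a1 := Fin.le_def.1 hk
        have a2 := k.2
        simp only at a1
        exact Fin.ext (by simp only; omega)
      exact h1
    have hl : ¬ (Sum.inl e.1.1 ∈ Y ∧ ∀ k ≤ (⟨j, hj⟩ : Fin (j + 1)), Sum.inr (e, k) ∈ Y) := by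
      rintro ⟨a1, a2⟩
      exact hY e ⟨a1, h2, fun k => a2 k (Fin.le_def.2 (by simp only; omega))⟩
    simp only [componentLabel]
    rw [if_neg hl, if_pos ⟨h2, hr⟩]

theorem componentLabel_eq_of_adj (ht : 0 < t) (hY : ∀ e, ¬ IsFullEdge Y e)
    (hcut : ∀ e i, Sum.inr (e, i) ∈ Y → (i : ℕ) ≠ cut e)
    {x y : V ⊕ (OrientedEdge G × Fin t)} (hx : x ∈ Y) (hy : y ∈ Y)
    (hxy : (subdivide G t).Adj x y) : componentLabel Y cut x = componentLabel Y cut y := by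
  obtain ⟨-, ⟨e, i, hi, rfl, rfl⟩ | ⟨e, i, hi, rfl, rfl⟩⟩ :=
    (SimpleGraph.fromRel_adj _ _ _).1 hxy
  · exact componentLabel_path_eq ht hY hcut e hi hx hy
  · exact (componentLabel_path_eq ht hY hcut e hi hy hx).symm

theorem componentLabel_inl_mem {x : V ⊕ (OrientedEdge G × Fin t)} (hx : x ∈ Y) {v : V}
    (h : componentLabel Y cut x = Sum.inl v) : Sum.inl v ∈ Y := by
  rcases x with u | ⟨e, i⟩
  · obtain rfl : u = v := Sum.inl.inj h
    exact hx
  · simp only [componentLabel] at h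
    split_ifs at h with h1 h2
    · obtain rfl := Sum.inl.inj h
      exact h1.1
    · obtain rfl := Sum.inl.inj h
      exact h2.1

/-- Deleting further vertices does not enlarge the component named by a vertex of `G`. -/
theorem componentLabel_mono {Y₀ : Set (V ⊕ (OrientedEdge G × Fin t))}
    {cut₀ : OrientedEdge G → ℕ} (hY₀ : ∀ e, ¬ IsFullEdge Y₀ e) (hYY : Y ⊆ Y₀)
    {x : V ⊕ (OrientedEdge G × Fin t)} {v : V}
    (h : componentLabel Y cut x = Sum.inl v) : componentLabel Y₀ cut₀ x = Sum.inl v := by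
  rcases x with u | ⟨e, i⟩
  · exact h
  · simp only [componentLabel] at h ⊢
    split_ifs at h with h1 h2
    · rw [if_pos ⟨hYY h1.1, fun j hj => hYY (h1.2 j hj)⟩]
      exact h
    · rw [if_neg, if_pos ⟨hYY h2.1, fun j hj => hYY (h2.2 j hj)⟩]
      · exact h
      · rintro ⟨a1, a2⟩
        refine hY₀ e ⟨a1, hYY h2.1, fun j => ?_⟩
        rcases le_total j i with hji | hji
        · exact a2 j hji
        · exact hYY (h2.2 j hji)

theorem componentLabel_inr {x : V ⊕ (OrientedEdge G × Fin t)} {e : OrientedEdge G} {b : Bool}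
    (h : componentLabel Y cut x = Sum.inr (e, b)) :
    ∃ i, x = Sum.inr (e, i) ∧ b = decide ((i : ℕ) < cut e) := by
  rcases x with u | ⟨e', i⟩
  · exact absurd h (by simp [componentLabel])
  · simp only [componentLabel] at h
    split_ifs at h with h1 h2
    have h' := Sum.inr.inj h
    obtain rfl : e' = e := congrArg Prod.fst h'
    exact ⟨i, rfl, (congrArg Prod.snd h').symm⟩

end Subdivision

/-- A labelling that is constant along the edges of `H - X` and has small fibers certifies that `X`
is a balanced separator. -/
theorem isBalancedSeparator_of_label {W L : Type} [Fintype W] [DecidableEq L] {H : SimpleGraph W}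
    {X : Finset W} (lab : W → L) (hadj : ∀ x ∉ X, ∀ y ∉ X, H.Adj x y → lab x = lab y)
    (hfib : ∀ l, ((Set.ncard {x | x ∉ X ∧ lab x = l} : ℕ) : ℝ) ≤ 2 * Fintype.card W / 3) :
    IsBalancedSeparator H X := by
  intro c
  obtain ⟨x₀, hx₀⟩ := c.nonempty_supp
  have key : ∀ u v : {v | v ∉ X}, (H.induce {v | v ∉ X}).Walk u v → lab u = lab v := by
    intro u v p
    induction p with
    | nil => rfl
    | @cons u v w h p ih => exact (hadj u.1 u.2 v.1 v.2 h).trans ih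
  refine le_trans ?_ (hfib (lab x₀))
  have h1 : c.supp.ncard = (Subtype.val '' c.supp).ncard :=
    (Set.ncard_image_of_injective _ Subtype.val_injective).symm
  rw [h1]
  norm_cast
  refine Set.ncard_le_ncard ?_ (Set.toFinite _)
  rintro _ ⟨x, hx, rfl⟩
  refine ⟨x.2, ?_⟩
  have hr : (H.induce {v | v ∉ X}).Reachable x x₀ :=
    SimpleGraph.ConnectedComponent.exact (hx.trans hx₀.symm)
  obtain ⟨p⟩ := hr
  exact key _ _ p

theorem exists_median {β : Type*} [Fintype β] (s : Set β) (g : β → ℕ) :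
    ∃ c : ℕ, 2 * {x ∈ s | g x < c}.ncard ≤ s.ncard ∧ 2 * {x ∈ s | c < g x}.ncard ≤ s.ncard := by
  classical
  have hex : ∃ c, s.ncard ≤ 2 * {x ∈ s | g x ≤ c}.ncard := by
    refine ⟨Finset.univ.sup g, ?_⟩
    have : {x ∈ s | g x ≤ Finset.univ.sup g} = s := by
      ext x
      exact ⟨fun h => h.1, fun h => ⟨h, Finset.le_sup (f := g) (Finset.mem_univ x)⟩⟩
    rw [this]
    omega
  refine ⟨Nat.find hex, ?_, ?_⟩
  · rcases Nat.eq_zero_or_pos (Nat.find hex) with h0 | h0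
    · rw [h0]
      simp
    · have h1 := Nat.find_min hex (m := Nat.find hex - 1) (by omega)
      have h2 : {x ∈ s | g x < Nat.find hex} = {x ∈ s | g x ≤ Nat.find hex - 1} := by
        ext x
        refine and_congr_right fun _ => ?_
        omega
      rw [h2]
      omega
  · have h1 := Nat.find_spec hex
    have h2 : {x ∈ s | g x ≤ Nat.find hex}.ncard + {x ∈ s | Nat.find hex < g x}.ncard
        = s.ncard := by
      rw [← Set.ncard_union_eq _ (Set.toFinite _) (Set.toFinite _)]
      · congr 1
        ext x
        constructor
        · rintro (h | h) <;> exact h.1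
        · intro h
          rcases le_or_gt (g x) (Nat.find hex) with h' | h'
          · exact Or.inl ⟨h, h'⟩
          · exact Or.inr ⟨h, h'⟩
      · rw [Set.disjoint_left]
        rintro x ⟨-, h⟩ ⟨-, h'⟩
        omega
    omega

/-- Two sets each containing more than two thirds of all elements meet. -/
theorem exists_mem_of_two_thirds {β : Type*} [Fintype β] {s s' : Set β}
    (h : (2 * Fintype.card β / 3 : ℝ) < s.ncard) (h' : (2 * Fintype.card β / 3 : ℝ) < s'.ncard) :
    ∃ x, x ∈ s ∧ x ∈ s' := by
  by_contra! hcon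
  have hd : Disjoint s s' := Set.disjoint_left.2 hcon
  have h1 := Set.ncard_union_eq hd (Set.toFinite _) (Set.toFinite _)
  have h2 : (s ∪ s').ncard ≤ Fintype.card β := by
    rw [← Nat.card_eq_fintype_card, ← Set.ncard_univ]
    exact Set.ncard_le_ncard (Set.subset_univ _) (Set.toFinite _)
  have h3 : (s.ncard : ℝ) + s'.ncard ≤ Fintype.card β := by exact_mod_cast h1 ▸ h2
  have h4 : (0 : ℝ) ≤ Fintype.card β := by positivity
  linarith

/-- Once all full edges are destroyed by `D`, the remaining components are subdivided stars and
paths, so deleting the center of a large star and the middle vertex of a large path suffices. -/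
theorem sepNumber_le_of_no_fullEdge {V W : Type} [LinearOrder V] [Fintype W] [DecidableEq W]
    {G : SimpleGraph V} {t : ℕ} (ht : 0 < t) {H : SimpleGraph W} (f : H ↪g subdivide G t)
    (D : Finset W) (hD : ∀ e, ¬ IsFullEdge (f '' {x | x ∉ D}) e) :
    sepNumber H ≤ D.card + 2 := by
  classical
  set n : ℝ := (Fintype.card W : ℝ) with hn
  set Y₀ := f '' {x | x ∉ D} with hY₀
  let onEdge : OrientedEdge G → Set W := fun e => {x | ∃ i, f x = Sum.inr (e, i)}
  let pos : V ⊕ (OrientedEdge G × Fin t) → ℕ := fun x => Sum.elim (fun _ => 0) (fun p => p.2) x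
  choose med hmed₁ hmed₂ using fun e => exists_median (onEdge e) fun x => pos (f x)
  let bigV : V → Prop := fun v =>
    2 * n / 3 < {x | x ∉ D ∧ componentLabel Y₀ (fun _ => 0) (f x) = Sum.inl v}.ncard
  let bigE : OrientedEdge G → Prop := fun e => 2 * n / 3 < (onEdge e).ncard
  -- edges that need not be cut get a cut position past their last vertex
  let cut : OrientedEdge G → ℕ := fun e => if bigE e then med e else t
  let X₁ : Finset W := Finset.univ.filter fun x => ∃ v, bigV v ∧ f x = Sum.inl v
  let X₂ : Finset W := Finset.univ.filter fun x =>
    ∃ e, ∃ i : Fin t, bigE e ∧ f x = Sum.inr (e, i) ∧ (i : ℕ) = med e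
  set X : Finset W := D ∪ (X₁ ∪ X₂) with hX
  have hX₁ : X₁.card ≤ 1 := by
    rw [Finset.card_le_one]
    intro x hx x' hx'
    obtain ⟨v, hv, hxv⟩ := (Finset.mem_filter.1 hx).2
    obtain ⟨v', hv', hxv'⟩ := (Finset.mem_filter.1 hx').2
    obtain ⟨z, ⟨-, hz⟩, -, hz'⟩ := exists_mem_of_two_thirds hv hv'
    obtain rfl : v = v' := Sum.inl.inj (hz.symm.trans hz')
    exact f.injective (hxv.trans hxv'.symm)
  have hX₂ : X₂.card ≤ 1 := by
    rw [Finset.card_le_one]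
    intro x hx x' hx'
    obtain ⟨e, i, he, hxe, hi⟩ := (Finset.mem_filter.1 hx).2
    obtain ⟨e', i', he', hxe', hi'⟩ := (Finset.mem_filter.1 hx').2
    obtain ⟨z, ⟨j, hz⟩, j', hz'⟩ := exists_mem_of_two_thirds he he'
    obtain rfl : e = e' := congrArg Prod.fst (Sum.inr.inj (hz.symm.trans hz'))
    obtain rfl : i = i' := Fin.ext (hi.trans hi'.symm)
    exact f.injective (hxe.trans hxe'.symm)
  have hXcard : X.card ≤ D.card + 2 := by
    have h1 := Finset.card_union_le D (X₁ ∪ X₂)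
    have h2 := Finset.card_union_le X₁ X₂
    rw [hX]
    omega
  refine le_trans (Nat.sInf_le ⟨X, ?_, rfl⟩) hXcard
  set Y := f '' {x | x ∉ X} with hY
  have hDX : ∀ x, x ∉ X → x ∉ D := fun x hx h => hx (Finset.mem_union_left _ h)
  have hX₁X : ∀ x, x ∉ X → x ∉ X₁ := fun x hx h =>
    hx (Finset.mem_union_right _ (Finset.mem_union_left _ h))
  have hX₂X : ∀ x, x ∉ X → x ∉ X₂ := fun x hx h =>
    hx (Finset.mem_union_right _ (Finset.mem_union_right _ h))
  have hYY : Y ⊆ Y₀ := Set.image_mono fun x hx => hDX x hx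
  have hYfull : ∀ e, ¬ IsFullEdge Y e := fun e he =>
    hD e ⟨hYY he.1, hYY he.2.1, fun i => hYY (he.2.2 i)⟩
  have hcut : ∀ e i, Sum.inr (e, i) ∈ Y → (i : ℕ) ≠ cut e := by
    rintro e i ⟨x, hx, hxe⟩ hi
    by_cases hb : bigE e
    · refine hX₂X x hx (Finset.mem_filter.2 ⟨Finset.mem_univ _, e, i, hb, hxe, ?_⟩)
      simpa only [cut, if_pos hb] using hi
    · simp only [cut, if_neg hb] at hi
      exact absurd i.2 (by omega)
  refine isBalancedSeparator_of_label (fun x => componentLabel Y cut (f x)) ?_ ?_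
  · intro x hx y hy hxy
    exact componentLabel_eq_of_adj ht hYfull hcut ⟨x, hx, rfl⟩ ⟨y, hy, rfl⟩ (f.map_rel_iff.2 hxy)
  · have hn0 : 0 ≤ n := by positivity
    rintro (v | ⟨e, b⟩)
    · by_cases hv : bigV v
      · have hempty : {x | x ∉ X ∧ componentLabel Y cut (f x) = Sum.inl v} = ∅ := by
          rw [Set.eq_empty_iff_forall_notMem]
          rintro x ⟨hx, hxv⟩
          obtain ⟨x', hx', hxv'⟩ := componentLabel_inl_mem (Y := Y) ⟨x, hx, rfl⟩ hxv
          exact hX₁X x' hx' (Finset.mem_filter.2 ⟨Finset.mem_univ _, v, hv, hxv'⟩)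
        rw [hempty]
        simp
        positivity
      · refine le_trans ?_ (not_lt.1 hv)
        norm_cast
        refine Set.ncard_le_ncard ?_ (Set.toFinite _)
        rintro x ⟨hx, hxv⟩
        exact ⟨hDX x hx, componentLabel_mono hD hYY hxv⟩
    · have hle : ((onEdge e).ncard : ℝ) ≤ n := by
        rw [hn, ← Nat.card_eq_fintype_card, ← Set.ncard_univ]
        exact_mod_cast Set.ncard_le_ncard (Set.subset_univ _) (Set.toFinite _)
      by_cases he : bigE e
      · have hsmall : ∀ P : Set W, 2 * P.ncard ≤ (onEdge e).ncard →
            {x | x ∉ X ∧ componentLabel Y cut (f x) = Sum.inr (e, b)} ⊆ P →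
            (({x | x ∉ X ∧ componentLabel Y cut (f x) = Sum.inr (e, b)}.ncard : ℕ) : ℝ)
              ≤ 2 * n / 3 := by
          intro P hP hsub
          have h1 : 2 * (P.ncard : ℝ) ≤ (onEdge e).ncard := by exact_mod_cast hP
          have h2 : (({x | x ∉ X ∧ componentLabel Y cut (f x) = Sum.inr (e, b)}.ncard : ℕ) : ℝ)
              ≤ P.ncard := by exact_mod_cast Set.ncard_le_ncard hsub (Set.toFinite _)
          linarith
        cases b with
        | true =>
          refine hsmall _ (hmed₁ e) ?_
          rintro x ⟨hx, hxe⟩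
          obtain ⟨i, hi, hb⟩ := componentLabel_inr hxe
          refine ⟨⟨i, hi⟩, ?_⟩
          have h3 : (i : ℕ) < cut e := by simpa using hb.symm
          simp only [cut, if_pos he] at h3
          rw [hi]
          exact h3
        | false =>
          refine hsmall _ (hmed₂ e) ?_
          rintro x ⟨hx, hxe⟩
          obtain ⟨i, hi, hb⟩ := componentLabel_inr hxe
          refine ⟨⟨i, hi⟩, ?_⟩
          have h3 : ¬ (i : ℕ) < cut e := by simpa using hb.symm
          have h4 : (i : ℕ) ≠ cut e := hcut e i ⟨x, hx, hi⟩
          simp only [cut, if_pos he] at h3 h4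
          rw [hi]
          change med e < (i : ℕ)
          omega
      · refine le_trans ?_ (not_lt.1 he)
        norm_cast
        refine Set.ncard_le_ncard ?_ (Set.toFinite _)
        rintro x ⟨hx, hxe⟩
        obtain ⟨i, hi, -⟩ := componentLabel_inr hxe
        exact ⟨i, hi⟩

/-- A separator of an induced subgraph of a subdivision may use either all vertices of `G`, or one
end of every full edge; each full edge accounts for `t` vertices. -/
theorem sepNumber_le_of_embedding {m t : ℕ} {W : Type} [Fintype W] [DecidableEq W]
    {G : SimpleGraph (Fin m)} (ht : 0 < t) {H : SimpleGraph W} (f : H ↪g subdivide G t) :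
    sepNumber H ≤ m + 2 ∧ ∃ N : ℕ, sepNumber H ≤ N + 2 ∧ N * t ≤ Fintype.card W := by
  classical
  constructor
  · refine (sepNumber_le_of_no_fullEdge ht f
      (Finset.univ.filter fun x => ∃ v, f x = Sum.inl v) ?_).trans (Nat.add_le_add_right ?_ 2)
    · rintro e ⟨⟨x, hx, hxe⟩, -⟩
      exact hx (Finset.mem_filter.2 ⟨Finset.mem_univ _, _, hxe⟩)
    · have hg : ∀ x, ∃ v : Option (Fin m), ∀ w, f x = Sum.inl w → v = some w := by
        intro x
        rcases hfx : f x with v | p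
        · exact ⟨some v, fun w hw => congrArg some (Sum.inl.inj hw)⟩
        · exact ⟨none, fun w hw => by simp at hw⟩
      choose g hg using hg
      have h1 : (Finset.univ.filter fun x => ∃ v, f x = Sum.inl v).card
          ≤ (Finset.univ.image (some : Fin m → Option (Fin m))).card := by
        refine Finset.card_le_card_of_injOn g ?_ ?_
        · intro x hx
          obtain ⟨v, hv⟩ := (Finset.mem_filter.1 hx).2
          rw [hg x v hv]
          exact Finset.mem_image_of_mem _ (Finset.mem_univ _)
        · intro x hx y hy hxy
          obtain ⟨v, hv⟩ := (Finset.mem_filter.1 hx).2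
          obtain ⟨w, hw⟩ := (Finset.mem_filter.1 hy).2
          rw [hg x v hv, hg y w hw] at hxy
          exact f.injective (by rw [hv, hw, Option.some.inj hxy])
      exact h1.trans (Finset.card_image_le.trans (by simp))
  · set E : Finset (OrientedEdge G) :=
      Finset.univ.filter fun e => IsFullEdge (Set.range f) e with hE
    refine ⟨E.card, (sepNumber_le_of_no_fullEdge ht f
      (Finset.univ.filter fun x => ∃ e ∈ E, f x = Sum.inl e.1.1) ?_).trans
        (Nat.add_le_add_right ?_ 2), ?_⟩
    · rintro e ⟨⟨x, hx, hxe⟩, ⟨y, -, hye⟩, hi⟩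
      refine hx (Finset.mem_filter.2 ⟨Finset.mem_univ _, e, Finset.mem_filter.2
        ⟨Finset.mem_univ _, ⟨x, hxe⟩, ⟨y, hye⟩, fun i => ?_⟩, hxe⟩)
      obtain ⟨z, -, hz⟩ := hi i
      exact ⟨z, hz⟩
    · have hg : ∀ x, ∃ e : Option (OrientedEdge G), (∃ e ∈ E, f x = Sum.inl e.1.1) →
          ∃ e' ∈ E, e = some e' ∧ f x = Sum.inl e'.1.1 := by
        intro x
        by_cases h : ∃ e ∈ E, f x = Sum.inl e.1.1
        · obtain ⟨e, he, hxe⟩ := h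
          exact ⟨some e, fun _ => ⟨e, he, rfl, hxe⟩⟩
        · exact ⟨none, fun h' => absurd h' h⟩
      choose g hg using hg
      have h1 : (Finset.univ.filter fun x => ∃ e ∈ E, f x = Sum.inl e.1.1).card
          ≤ (E.image some).card := by
        refine Finset.card_le_card_of_injOn g ?_ ?_
        · intro x hx
          obtain ⟨e, he, h2, -⟩ := hg x (Finset.mem_filter.1 hx).2
          rw [h2]
          exact Finset.mem_image_of_mem _ he
        · intro x hx y hy hxy
          obtain ⟨e, he, h2, h3⟩ := hg x (Finset.mem_filter.1 hx).2
          obtain ⟨e', he', h2', h3'⟩ := hg y (Finset.mem_filter.1 hy).2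
          rw [h2, h2'] at hxy
          exact f.injective (by rw [h3, h3', Option.some.inj hxy])
      exact h1.trans Finset.card_image_le
    · have hz : ∀ p : OrientedEdge G × Fin t, ∃ x : Option W, p.1 ∈ E →
          ∃ x', x = some x' ∧ f x' = Sum.inr p := by
        intro p
        by_cases h : p.1 ∈ E
        · obtain ⟨x, hx⟩ := (Finset.mem_filter.1 h).2.2.2 p.2
          exact ⟨some x, fun _ => ⟨x, rfl, hx⟩⟩
        · exact ⟨none, fun h' => absurd h' h⟩
      choose g hg using hz
      have h1 : (E ×ˢ (Finset.univ : Finset (Fin t))).card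
          ≤ (Finset.univ.image (some : W → Option W)).card := by
        refine Finset.card_le_card_of_injOn g ?_ ?_
        · intro p hp
          obtain ⟨x, h2, -⟩ := hg p (Finset.mem_product.1 hp).1
          rw [h2]
          exact Finset.mem_image_of_mem _ (Finset.mem_univ _)
        · intro p hp p' hp' hpp
          obtain ⟨x, h2, h3⟩ := hg p (Finset.mem_product.1 hp).1
          obtain ⟨x', h2', h3'⟩ := hg p' (Finset.mem_product.1 hp').1
          rw [h2, h2'] at hpp
          rw [Option.some.inj hpp] at h3
          exact Sum.inr.inj (h3.symm.trans h3')
      rw [Finset.card_product, Finset.card_univ, Fintype.card_fin] at h1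
      exact h1.trans (Finset.card_image_le.trans (by simp))

/-! ### The separators of the subdivided graphs -/

theorem isHereditary_epsSubdivisionClass (ε : ℝ) (𝒢 : Set FinGraph) :
    IsHereditary (epsSubdivisionClass ε 𝒢) := by
  rintro H ⟨G, hG, ⟨f⟩⟩ H' ⟨g⟩
  exact ⟨G, hG, ⟨f.comp g⟩⟩

theorem subdivisionCount_pos {ε : ℝ} {m : ℕ} (hm : 0 < m) : 0 < subdivisionCount ε m :=
  Nat.ceil_pos.2 (Real.rpow_pos_of_pos (by exact_mod_cast hm) _)

/-- With `n` vertices in an induced subgraph of `G ^ ε`, where `G` has `m` vertices: either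
`m ≤ n ^ (1 - ε)`, or at most `n / m ^ (ε / (1 - ε)) ≤ n ^ (1 - ε)` full edges fit. -/
theorem classSep_epsSubdivisionClass_le {ε : ℝ} (hε0 : 0 < ε) (hε1 : ε < 1) (𝒢 : Set FinGraph)
    (n : ℕ) : (classSep (epsSubdivisionClass ε 𝒢) n : ℝ) ≤ 3 * (n : ℝ) ^ (1 - ε) := by
  have hα : 0 < 1 - ε := by linarith
  have key : ∀ H ∈ epsSubdivisionClass ε 𝒢, (sepNumber H.2 : ℝ) ≤ 3 * (H.1 : ℝ) ^ (1 - ε) := by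
    rintro ⟨n, H⟩ ⟨⟨m, G⟩, -, ⟨f⟩⟩
    change (sepNumber H : ℝ) ≤ 3 * (n : ℝ) ^ (1 - ε)
    rcases Nat.eq_zero_or_pos n with rfl | hn
    · have : sepNumber H ≤ 0 := (sepNumber_le_card H).trans (by simp)
      rw [Nat.le_zero.1 this]
      simp
      positivity
    have hm : 0 < m := by
      rcases f ⟨0, hn⟩ with v | ⟨e, -⟩
      · exact v.pos
      · exact e.1.1.pos
    have hn1 : (1 : ℝ) ≤ n := by exact_mod_cast hn
    have hn0 : (0 : ℝ) < n := by linarith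
    have hp1 : 1 ≤ (n : ℝ) ^ (1 - ε) := Real.one_le_rpow hn1 hα.le
    obtain ⟨h1, N, h2, h3⟩ := sepNumber_le_of_embedding (subdivisionCount_pos hm) f
    rcases le_or_gt (m : ℝ) ((n : ℝ) ^ (1 - ε)) with hmn | hmn
    · have : (sepNumber H : ℝ) ≤ m + 2 := by exact_mod_cast h1
      linarith
    · have h4 : (sepNumber H : ℝ) ≤ N + 2 := by exact_mod_cast h2
      have h5 : (N : ℝ) * subdivisionCount ε m ≤ n := by
        rw [Fintype.card_fin] at h3
        exact_mod_cast h3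
      have h6 : (n : ℝ) ^ ε ≤ subdivisionCount ε m := by
        calc (n : ℝ) ^ ε = ((n : ℝ) ^ (1 - ε)) ^ (ε / (1 - ε)) := by
              rw [← Real.rpow_mul hn0.le, mul_div_cancel₀ _ hα.ne']
          _ ≤ (m : ℝ) ^ (ε / (1 - ε)) :=
              Real.rpow_le_rpow (by positivity) hmn.le (by positivity)
          _ ≤ subdivisionCount ε m := Nat.le_ceil _
      have h7 : (N : ℝ) ≤ (n : ℝ) ^ (1 - ε) := by
        rw [Real.rpow_sub hn0, Real.rpow_one, le_div_iff₀ (by positivity)]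
        exact (mul_le_mul_of_nonneg_left h6 (Nat.cast_nonneg _)).trans h5
      linarith
  rcases Set.eq_empty_or_nonempty
      {k | ∃ G ∈ epsSubdivisionClass ε 𝒢, G.1 ≤ n ∧ sepNumber G.2 = k} with h0 | h0
  · unfold classSep
    rw [h0]
    simp
    positivity
  · obtain ⟨H, hH, hHn, hk⟩ := Nat.sSup_mem h0 (bddAbove_classSep _ n)
    unfold classSep
    rw [← hk]
    refine (key H hH).trans (mul_le_mul_of_nonneg_left ?_ (by norm_num))
    exact Real.rpow_le_rpow (by positivity) (by exact_mod_cast hHn) hα.le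

/-- A graph on `m` vertices with `O(m)` edges in which any two disjoint sets of at least `m / 6`
vertices are joined by an edge: a hitting set for the sets of pairs between them. -/
theorem exists_linear_expander {m : ℕ} (hm : 0 < m) :
    ∃ F : Finset (Fin m × Fin m), (F.card : ℝ) ≤ 73 * m ∧ (∀ p ∈ F, p.1 ≠ p.2) ∧
      ∀ A B : Finset (Fin m), Disjoint A B → (m : ℝ) / 6 ≤ A.card → (m : ℝ) / 6 ≤ B.card →
        ∃ p ∈ F, p.1 ∈ A ∧ p.2 ∈ B := by
  classical
  have hm1 : (1 : ℝ) ≤ m := by exact_mod_cast hm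
  have : Nonempty (Fin m) := ⟨⟨0, hm⟩⟩
  set s : Finset (Finset (Fin m) × Finset (Fin m)) := Finset.univ.filter fun P =>
    Disjoint P.1 P.2 ∧ (m : ℝ) / 6 ≤ P.1.card ∧ (m : ℝ) / 6 ≤ P.2.card with hs
  obtain ⟨F, -, hFc, hF⟩ := exists_hittingSet (E := (Finset.univ : Finset (Fin m × Fin m)))
    (s := s) (I := fun P => P.1 ×ˢ P.2) (θ := 1 / 36) (by norm_num) Finset.univ_nonempty
    (fun _ _ => Finset.subset_univ _)
    (by
      intro P hP
      obtain ⟨-, -, h1, h2⟩ := Finset.mem_filter.1 hP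
      rw [Finset.card_product, Finset.card_univ, Fintype.card_prod, Fintype.card_fin]
      push_cast
      nlinarith)
  refine ⟨F.filter fun p => p.1 ≠ p.2, ?_, fun p hp => (Finset.mem_filter.1 hp).2, ?_⟩
  · have h1 : ((F.filter fun p => p.1 ≠ p.2).card : ℝ) ≤ F.card := by
      exact_mod_cast Finset.card_filter_le _ _
    have h2 : Real.log s.card ≤ 2 * m := by
      rcases s.eq_empty_or_nonempty with h0 | h0
      · rw [h0]; simp
      rw [Real.log_le_iff_le_exp (by exact_mod_cast h0.card_pos)]
      have h3 : (s.card : ℝ) ≤ 4 ^ m := by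
        have : s.card ≤ 2 ^ m * 2 ^ m :=
          (Finset.card_filter_le _ _).trans (by simp)
        rw [← mul_pow] at this
        exact_mod_cast this
      exact h3.trans (four_pow_le_exp m)
    have h4 : Real.log s.card / (1 / 36) = 36 * Real.log s.card := by ring
    rw [h4] at hFc
    linarith
  · intro A B hAB hA hB
    obtain ⟨p, hp, hpAB⟩ := hF (A, B) (Finset.mem_filter.2 ⟨Finset.mem_univ _, hAB, hA, hB⟩)
    rw [Finset.mem_product] at hpAB
    refine ⟨p, Finset.mem_filter.2 ⟨hp, ?_⟩, hpAB⟩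
    intro h
    exact Finset.disjoint_left.1 hAB hpAB.1 (h ▸ hpAB.2)

theorem card_orientedEdge_fromRel_le {m : ℕ} (F : Finset (Fin m × Fin m))
    [Fintype (OrientedEdge (SimpleGraph.fromRel fun a b => (a, b) ∈ F))] :
    Fintype.card (OrientedEdge (SimpleGraph.fromRel fun a b => (a, b) ∈ F)) ≤ F.card := by
  rw [← Finset.card_univ]
  refine Finset.card_le_card_of_injOn
    (fun e => if (e.1.1, e.1.2) ∈ F then (e.1.1, e.1.2) else (e.1.2, e.1.1)) ?_ ?_
  · intro e _
    have he := ((SimpleGraph.fromRel_adj _ _ _).1 e.2.2).2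
    by_cases h : (e.1.1, e.1.2) ∈ F
    · simp only [if_pos h]; exact h
    · simp only [if_neg h]; exact he.resolve_left h
  · rintro ⟨⟨a, b⟩, hab, hab'⟩ _ ⟨⟨c, d⟩, hcd, hcd'⟩ _ h
    replace h : (if (a, b) ∈ F then (a, b) else (b, a)) =
      if (c, d) ∈ F then (c, d) else (d, c) := h
    replace hab : a < b := hab
    replace hcd : c < d := hcd
    -- the orientation `a < b` recovers the pair from either of its two orders
    by_cases h1 : (a, b) ∈ F <;> by_cases h2 : (c, d) ∈ F <;>
      simp only [h1, h2, ↓reduceIte, Prod.mk.injEq] at h <;> obtain ⟨rfl, rfl⟩ := h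
    · rfl
    · exact absurd hcd (not_lt.2 hab.le)
    · exact absurd hcd (not_lt.2 hab.le)
    · rfl

/-- Subdividing an expander with `m = Θ(n ^ (1 - ε))` vertices and `O(m)` edges gives a graph with
at most `n` vertices. A cut of `m / 6` vertices of the expander is forced by `O(1)` separators of
size `s(n)` followed by the separators of the remaining much smaller pieces, and the latter are
bounded by the upper bound on `s`. -/
theorem exists_le_classSep_epsSubdivisionClass {ε : ℝ} (hε0 : 0 < ε) (hε1 : ε < 1) :
    ∃ c : ℝ, 0 < c ∧ ∀ n : ℕ, 147 ≤ n →
      c * (n : ℝ) ^ (1 - ε) ≤ classSep (epsSubdivisionClass ε Set.univ) n := by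
  classical
  set α := 1 - ε with hα
  have hα0 : 0 < α := by linarith
  have hq1 : (2 / 3 : ℝ) ^ α < 1 := Real.rpow_lt_one (by norm_num) (by norm_num) hα0
  have hq0 : 0 < (2 / 3 : ℝ) ^ α := by positivity
  set C' : ℝ := 3 / (1 - (2 / 3) ^ α) with hC'
  have hC'0 : 0 < C' := div_pos (by norm_num) (by linarith)
  -- `κ n ^ α` is at most the number `m / 6` of vertices needed to cut the expander
  set κ : ℝ := (1 / 147) ^ α / 12 with hκ
  have hκ0 : 0 < κ := by positivity
  -- after `I` steps, the remaining separators contribute at most half of that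
  obtain ⟨I₀, hI₀⟩ := exists_pow_lt_of_lt_one (show 0 < κ / (2 * C') by positivity) hq1
  set I := I₀ + 1 with hI
  have hIsmall : C' * ((2 / 3 : ℝ) ^ I) ^ α ≤ κ / 2 := by
    have h1 : ((2 / 3 : ℝ) ^ I) ^ α = ((2 / 3 : ℝ) ^ α) ^ I := by
      rw [← Real.rpow_natCast, ← Real.rpow_natCast, ← Real.rpow_mul (by norm_num),
        ← Real.rpow_mul (by norm_num), mul_comm]
    have h2 : ((2 / 3 : ℝ) ^ α) ^ I ≤ κ / (2 * C') :=
      (pow_le_pow_of_le_one hq0.le hq1.le (by omega)).trans hI₀.le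
    rw [h1]
    calc C' * ((2 / 3 : ℝ) ^ α) ^ I ≤ C' * (κ / (2 * C')) :=
          mul_le_mul_of_nonneg_left h2 hC'0.le
      _ = κ / 2 := by field_simp
  have hIpos : (0 : ℝ) < I := by rw [hI]; positivity
  refine ⟨κ / (2 * I), by positivity, fun n hn => ?_⟩
  have hn147 : (147 : ℝ) ≤ n := by exact_mod_cast hn
  have hn0 : (0 : ℝ) < n := by linarith
  -- `73 m` edges subdivided at most `2 m ^ (ε / α)` times give, together with the `m` original
  -- vertices, at most `147 m ^ (1 / α)` vertices
  set y : ℝ := ((n : ℝ) / 147) ^ α with hy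
  have hy1 : 1 ≤ y := Real.one_le_rpow (by rw [le_div_iff₀ (by norm_num)]; linarith) hα0.le
  have hyκ : y = 12 * κ * (n : ℝ) ^ α := by
    rw [hy, hκ, div_eq_mul_one_div, Real.mul_rpow hn0.le (by norm_num)]
    ring
  set m := ⌊y⌋₊ with hm
  have hmy : (m : ℝ) ≤ y := Nat.floor_le (by linarith)
  have hm0 : 0 < m := Nat.floor_pos.2 hy1
  have hm1 : (1 : ℝ) ≤ m := by exact_mod_cast hm0
  have hym : y ≤ 2 * m := by linarith [Nat.lt_floor_add_one y]
  obtain ⟨F, hFc, hFne, hF⟩ := exists_linear_expander hm0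
  set G : SimpleGraph (Fin m) := SimpleGraph.fromRel fun a b => (a, b) ∈ F with hG
  set t := subdivisionCount ε m with ht
  have hcard : (Finset.univ : Finset (Fin m ⊕ (OrientedEdge G × Fin t))).card ≤ n := by
    have h1 : (Fintype.card (OrientedEdge G) : ℝ) ≤ 73 * m :=
      le_trans (by exact_mod_cast card_orientedEdge_fromRel_le F) hFc
    have hmp : 1 ≤ (m : ℝ) ^ (ε / α) := Real.one_le_rpow hm1 (by positivity)
    have h2 : (t : ℝ) ≤ 2 * (m : ℝ) ^ (ε / α) := by
      have := (Nat.ceil_lt_add_one (show 0 ≤ (m : ℝ) ^ (ε / α) by positivity)).le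
      have h3 : (t : ℝ) ≤ (m : ℝ) ^ (ε / α) + 1 := this
      linarith
    have h3 : (m : ℝ) * (m : ℝ) ^ (ε / α) ≤ n / 147 := by
      calc (m : ℝ) * (m : ℝ) ^ (ε / α) = (m : ℝ) ^ (1 / α) := by
            have h4 : 1 / α = 1 + ε / α := by field_simp; rw [hα]; ring
            rw [h4, Real.rpow_add (by linarith), Real.rpow_one]
        _ ≤ y ^ (1 / α) := Real.rpow_le_rpow (by linarith) hmy (by positivity)
        _ = n / 147 := by
            rw [hy, ← Real.rpow_mul (by positivity), mul_one_div_cancel hα0.ne', Real.rpow_one]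
    rw [Finset.card_univ, Fintype.card_sum, Fintype.card_prod, Fintype.card_fin, Fintype.card_fin]
    have h5 : (m : ℝ) + Fintype.card (OrientedEdge G) * t ≤ n := by
      have h6 : (Fintype.card (OrientedEdge G) : ℝ) * t ≤ 73 * m * (2 * (m : ℝ) ^ (ε / α)) :=
        mul_le_mul h1 h2 (by positivity) (by positivity)
      have h7 : (m : ℝ) ≤ m * (m : ℝ) ^ (ε / α) := le_mul_of_one_le_right (by linarith) hmp
      linarith
    exact_mod_cast h5
  set σ : ℝ := (classSep (epsSubdivisionClass ε Set.univ) n : ℝ) with hσ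
  set s : ℝ := I * σ + C' * ((2 / 3) ^ I *
    ((Finset.univ : Finset (Fin m ⊕ (OrientedEdge G × Fin t))).card : ℝ)) ^ α with hs
  have hclass : ∀ H : FinGraph, Nonempty (H.2 ↪g subdivide G t) →
      H ∈ epsSubdivisionClass ε Set.univ := fun H hH => ⟨⟨m, G⟩, trivial, hH⟩
  obtain ⟨A, -, B, -, hAB, hA, hB, hrest, hno⟩ := exists_cut_of_minor_model
    (G := subdivide G t) (Z := Finset.univ) (B := subdivisionStar G t) (U := Finset.univ) (F := F)
    (s := s) (fun _ _ => by simp)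
    (fun u => by
      have hne : Nonempty (subdivisionStar G t u) := ⟨⟨Sum.inl u, Or.inl rfl⟩⟩
      refine SimpleGraph.radius_ne_top_iff.1 (ne_top_of_le_ne_top (ENat.natCast_ne_top t) ?_)
      exact radius_subdivisionStar_le u)
    (fun _ _ h => disjoint_subdivisionStar h)
    (fun p hp => exists_adj_subdivisionStar
      ((SimpleGraph.fromRel_adj _ _ _).2 ⟨hFne p hp, Or.inl hp⟩))
    (fun T τ hT => hasWeightedSeparation_of_steps hclass hα0 (by norm_num)
      (classSep_epsSubdivisionClass_le hε0 hε1 Set.univ) I Finset.univ hcard hT)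
  rw [Finset.card_univ, Fintype.card_fin] at hA hB
  have hsum : (A.card : ℝ) + B.card + (Finset.univ \ (A ∪ B)).card = m := by
    have h1 := Finset.card_sdiff_add_card_eq_card (Finset.subset_univ (A ∪ B))
    rw [Finset.card_union_of_disjoint hAB, Finset.card_univ, Fintype.card_fin] at h1
    rw [add_comm]
    exact_mod_cast h1
  have hsm : (m : ℝ) / 6 < s := by
    by_contra! hle
    obtain ⟨p, hp, hpA, hpB⟩ := hF A B hAB (by linarith) (by linarith)
    exact hno p hp (Or.inl ⟨hpA, hpB⟩)
  have hs2 : s ≤ I * σ + κ / 2 * (n : ℝ) ^ α := by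
    have h1 : ((2 / 3) ^ I *
        ((Finset.univ : Finset (Fin m ⊕ (OrientedEdge G × Fin t))).card : ℝ)) ^ α
        ≤ ((2 / 3 : ℝ) ^ I) ^ α * (n : ℝ) ^ α := by
      rw [← Real.mul_rpow (by positivity) hn0.le]
      refine Real.rpow_le_rpow (by positivity) ?_ hα0.le
      exact mul_le_mul_of_nonneg_left (by exact_mod_cast hcard) (by positivity)
    have h2 := mul_le_mul_of_nonneg_left h1 hC'0.le
    have h3 := mul_le_mul_of_nonneg_right hIsmall (show 0 ≤ (n : ℝ) ^ α by positivity)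
    rw [hs]
    linarith
  rw [div_mul_eq_mul_div, div_le_iff₀ (by positivity)]
  linarith

theorem hasSepExponent_epsSubdivisionClass {ε : ℝ} (hε0 : 0 < ε) (hε1 : ε < 1) :
    HasSepExponent (epsSubdivisionClass ε Set.univ) ε := by
  constructor
  · refine IsBigO.of_bound 3 (Eventually.of_forall fun n => ?_)
    rw [Real.norm_of_nonneg (by positivity), Real.norm_of_nonneg (by positivity)]
    exact classSep_epsSubdivisionClass_le hε0 hε1 _ n
  · obtain ⟨c, hc, h⟩ := exists_le_classSep_epsSubdivisionClass hε0 hε1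
    refine IsBigO.of_bound c⁻¹ (eventually_atTop.2 ⟨147, fun n hn => ?_⟩)
    rw [Real.norm_of_nonneg (by positivity), Real.norm_of_nonneg (by positivity),
      inv_mul_eq_div, le_div_iff₀ hc, mul_comm]
    exact h n hn

/-! ### The expansion of the subdivided graphs -/

/-- For `m = ⌊r ^ (1 / ε - 1)⌋` the edges of `K_m` are subdivided at most `r` times. -/
theorem isShallowMinor_epsSubdivision_top {ε : ℝ} (hε0 : 0 < ε) (hε1 : ε < 1) (r : ℕ) :
    IsShallowMinor r (⊤ : SimpleGraph (Fin ⌊(r : ℝ) ^ (1 / ε - 1)⌋₊))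
      (epsSubdivision ε (⊤ : SimpleGraph (Fin ⌊(r : ℝ) ^ (1 / ε - 1)⌋₊))) := by
  refine isShallowMinor_subdivide (Nat.ceil_le.2 ?_)
  have hα : 0 < 1 - ε := by linarith
  have h1 : (⌊(r : ℝ) ^ (1 / ε - 1)⌋₊ : ℝ) ≤ (r : ℝ) ^ (1 / ε - 1) := Nat.floor_le (by positivity)
  calc (⌊(r : ℝ) ^ (1 / ε - 1)⌋₊ : ℝ) ^ (ε / (1 - ε))
      ≤ ((r : ℝ) ^ (1 / ε - 1)) ^ (ε / (1 - ε)) :=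
        Real.rpow_le_rpow (by positivity) h1 (by positivity)
    _ = r := by
        rw [← Real.rpow_mul (by positivity),
          show (1 / ε - 1) * (ε / (1 - ε)) = 1 by field_simp, Real.rpow_one]

theorem IsShallowMinor.of_iso {W V V' : Type} {r : ℕ} {H : SimpleGraph W} {G : SimpleGraph V}
    {G' : SimpleGraph V'} (φ : G ≃g G') (h : IsShallowMinor r H G) : IsShallowMinor r H G' := by
  obtain ⟨B, h1, h2, h3⟩ := h
  refine ⟨fun w => φ '' B w, fun w => ?_, fun u w huw => ?_, fun u w huw => ?_⟩
  · let ψ : G.induce (B w) →g G'.induce (φ '' B w) :=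
      { toFun := fun x => ⟨φ x, x, x.2, rfl⟩
        map_rel' := fun h => φ.map_rel_iff.2 h }
    obtain ⟨c, hc⟩ := exists_walk_of_radius_le (h1 w)
    refine (SimpleGraph.radius_le_eccent (u := ψ c)).trans ?_
    rw [SimpleGraph.eccent_le_iff]
    rintro ⟨_, x, hx, rfl⟩
    obtain ⟨p, hp⟩ := hc ⟨x, hx⟩
    have h4 := SimpleGraph.Walk.edist_le (p.map ψ)
    rw [SimpleGraph.Walk.length_map] at h4
    exact h4.trans (by exact_mod_cast hp)
  · exact (Set.disjoint_image_iff φ.injective).2 (h2 u w huw)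
  · obtain ⟨x, hx, y, hy, hxy⟩ := h3 u w huw
    exact ⟨φ x, ⟨x, hx, rfl⟩, φ y, ⟨y, hy, rfl⟩, φ.map_rel_iff.2 hxy⟩

theorem nablaIsBigOmega_epsSubdivisionClass {ε : ℝ} (hε0 : 0 < ε) (hε1 : ε < 1) :
    NablaIsBigOmega (epsSubdivisionClass ε Set.univ) (1 / ε - 1) := by
  classical
  have hb : 0 < 1 / ε - 1 := by
    have := (one_lt_div hε0).2 hε1
    linarith
  refine ⟨1 / 8, by norm_num, ?_⟩
  have hev : ∀ᶠ r : ℕ in atTop, (2 : ℝ) ≤ (r : ℝ) ^ (1 / ε - 1) :=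
    ((tendsto_rpow_atTop hb).comp tendsto_natCast_atTop_atTop).eventually_ge_atTop 2
  filter_upwards [hev] with r hr
  set m := ⌊(r : ℝ) ^ (1 / ε - 1)⌋₊ with hm
  have hm2 : 2 ≤ m := Nat.le_floor hr
  have hmr : (r : ℝ) ^ (1 / ε - 1) < m + 1 := Nat.lt_floor_add_one _
  have hm2' : (2 : ℝ) ≤ m := by exact_mod_cast hm2
  let P := Fin m ⊕ (OrientedEdge (⊤ : SimpleGraph (Fin m)) × Fin (subdivisionCount ε m))
  let G' : FinGraph := ⟨Fintype.card P,
    (epsSubdivision ε (⊤ : SimpleGraph (Fin m))).map (Fintype.equivFin P).toEmbedding⟩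
  let φ : epsSubdivision ε (⊤ : SimpleGraph (Fin m)) ≃g G'.2 :=
    SimpleGraph.Iso.map (Fintype.equivFin P) _
  have hG' : G' ∈ epsSubdivisionClass ε Set.univ := ⟨⟨m, ⊤⟩, trivial, ⟨φ.symm.toEmbedding⟩⟩
  have hminor : IsShallowMinor r (⊤ : SimpleGraph (Fin m)) G'.2 :=
    (isShallowMinor_epsSubdivision_top hε0 hε1 r).of_iso φ
  have hdens : density ⟨m, ⊤⟩ ≤ classNabla (epsSubdivisionClass ε Set.univ) r :=
    (le_iSup₂_of_le (f := fun (H : FinGraph) (_ : IsShallowMinor r H.2 G'.2) => density H)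
      ⟨m, ⊤⟩ hminor le_rfl).trans
      (le_iSup₂_of_le (f := fun (G : FinGraph) (_ : G ∈ epsSubdivisionClass ε Set.univ) =>
        nabla r G) G' hG' le_rfl)
  refine le_trans ?_ hdens
  rw [density_eq_ofReal (show m ≠ 0 by omega)]
  refine ENNReal.ofReal_le_ofReal ?_
  have hedges : 2 * ((⊤ : SimpleGraph (Fin m)).edgeSet.ncard : ℝ) = m * (m - 1) := by
    have h1 : (⊤ : SimpleGraph (Fin m)).edgeSet.ncard = m.choose 2 := by
      rw [← SimpleGraph.coe_edgeFinset, Set.ncard_coe_finset,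
        SimpleGraph.card_edgeFinset_top_eq_card_choose_two, Fintype.card_fin]
    rw [h1, Nat.cast_choose_two]
    ring
  change _ ≤ ((⊤ : SimpleGraph (Fin m)).edgeSet.ncard : ℝ) / (m : ℝ)
  rw [le_div_iff₀ (by linarith)]
  nlinarith

/-! ### The expansion exponent -/

/-- The graphs with at most two vertices have constant separators, and the single edge keeps their
shallow minors from having density tending to `0`. -/
theorem exists_class_of_exponent_one :
    ∃ 𝒢 : Set FinGraph, IsHereditary 𝒢 ∧ HasSepExponent 𝒢 1 ∧ NablaIsBigOmega 𝒢 0 := by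
  refine ⟨{G | G.1 ≤ 2}, ?_, ?_, ?_⟩
  · rintro G hG H ⟨f⟩
    have := Fintype.card_le_of_embedding f.toEmbedding
    rw [Fintype.card_fin, Fintype.card_fin] at this
    exact this.trans hG
  · have hup : ∀ n, classSep {G | G.1 ≤ 2} n ≤ 2 := fun n =>
      classSep_le fun G hG _ => (sepNumber_le_card G.2).trans (by simpa using hG)
    have hlow : ∀ n, 1 ≤ n → 1 ≤ classSep {G | G.1 ≤ 2} n := by
      intro n hn
      -- the empty set does not separate the single vertex, which is more than two thirds of itself
      have h1 : 1 ≤ sepNumber (⊥ : SimpleGraph (Fin 1)) := by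
        obtain ⟨X, hX, hXc⟩ := Nat.sInf_mem
          (s := {k | ∃ X : Finset (Fin 1), IsBalancedSeparator (⊥ : SimpleGraph (Fin 1)) X ∧
            X.card = k}) ⟨_, Finset.univ, isBalancedSeparator_univ _, rfl⟩
        change X.card = sepNumber (⊥ : SimpleGraph (Fin 1)) at hXc
        rw [← hXc]
        by_contra h
        have hX0 : X = ∅ := Finset.card_eq_zero.1 (by omega)
        subst hX0
        set c := ((⊥ : SimpleGraph (Fin 1)).induce
          {v | v ∉ (∅ : Finset (Fin 1))}).connectedComponentMk ⟨0, Finset.notMem_empty _⟩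
        have h2 := hX c
        have h3 : 0 < c.supp.ncard := (Set.ncard_pos (Set.toFinite _)).2 c.nonempty_supp
        have h4 : (1 : ℝ) ≤ c.supp.ncard := by exact_mod_cast h3
        rw [Fintype.card_fin] at h2
        norm_num at h2
        linarith
      exact h1.trans (le_csSup (bddAbove_classSep _ n) ⟨⟨1, ⊥⟩, by simp, hn, rfl⟩)
    constructor
    · refine IsBigO.of_bound 2 (Eventually.of_forall fun n => ?_)
      simp only [sub_self, Real.rpow_zero, norm_one, mul_one, Real.norm_natCast]
      exact_mod_cast hup n
    · refine IsBigO.of_bound 1 (eventually_atTop.2 ⟨1, fun n hn => ?_⟩)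
      simp only [sub_self, Real.rpow_zero, norm_one, one_mul, Real.norm_natCast]
      exact_mod_cast hlow n hn
  · refine ⟨1 / 2, by norm_num, Eventually.of_forall fun r => ?_⟩
    rw [Real.rpow_zero, mul_one]
    let K : FinGraph := ⟨2, ⊤⟩
    have hself : IsShallowMinor r K.2 K.2 := by
      refine ⟨fun v => {v}, fun v => ?_, fun u w h => by simpa using h,
        fun u w h => ⟨u, rfl, w, rfl, h⟩⟩
      have : (K.2.induce {v}).radius = 0 :=
        SimpleGraph.radius_eq_zero_iff.2 ⟨⟨⟨v, rfl⟩⟩, inferInstance⟩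
      rw [this]
      exact zero_le
    have hdens : density K ≤ classNabla {G | G.1 ≤ 2} r :=
      (le_iSup₂_of_le (f := fun (H : FinGraph) (_ : IsShallowMinor r H.2 K.2) => density H)
        K hself le_rfl).trans
        (le_iSup₂_of_le (f := fun (G : FinGraph) (_ : G ∈ {G : FinGraph | G.1 ≤ 2}) => nabla r G)
          K (show (2 : ℕ) ≤ 2 from le_rfl) le_rfl)
    refine le_trans ?_ hdens
    rw [density_eq_ofReal (show (2 : ℕ) ≠ 0 by norm_num)]
    refine ENNReal.ofReal_le_ofReal ?_
    have h1 : (⊤ : SimpleGraph (Fin 2)).edgeSet.ncard = 1 := by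
      rw [← SimpleGraph.coe_edgeFinset, Set.ncard_coe_finset,
        SimpleGraph.card_edgeFinset_top_eq_card_choose_two, Fintype.card_fin]
      rfl
    change _ ≤ ((⊤ : SimpleGraph (Fin 2)).edgeSet.ncard : ℝ) / ((2 : ℕ) : ℝ)
    rw [h1]
    norm_num

/-- The bounds `∇(r) = Ω(r ^ b)` and `∇(r) = O(r ^ B)` are compatible only if `b ≤ B`. -/
theorem le_of_nablaIsBigOmega_of_nablaIsBigO {𝒢 : Set FinGraph} {b B : ℝ}
    (h : NablaIsBigOmega 𝒢 b) (h' : NablaIsBigO 𝒢 B) : b ≤ B := by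
  obtain ⟨c, hc, h⟩ := h
  obtain ⟨C, h'⟩ := h'
  by_contra! hlt
  have htend : Tendsto (fun r : ℕ => (r : ℝ) ^ (b - B)) atTop atTop :=
    (tendsto_rpow_atTop (by linarith)).comp tendsto_natCast_atTop_atTop
  obtain ⟨r, h1, h2, h3, h4⟩ := (h.and (h'.and ((htend.eventually_gt_atTop (C / c)).and
    (eventually_ge_atTop 1)))).exists
  have hr0 : (0 : ℝ) < r := by exact_mod_cast h4
  have h5 : c * (r : ℝ) ^ b ≤ C * (r : ℝ) ^ B := by
    have h6 := h1.trans h2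
    have h7 : 0 < c * (r : ℝ) ^ b := by positivity
    rcases le_or_gt (C * (r : ℝ) ^ B) 0 with h8 | h8
    · rw [ENNReal.ofReal_of_nonpos h8, nonpos_iff_eq_zero, ENNReal.ofReal_eq_zero] at h6
      linarith
    · exact (ENNReal.ofReal_le_ofReal_iff h8.le).1 h6
  rw [div_lt_iff₀ hc, Real.rpow_sub hr0, div_mul_eq_mul_div, lt_div_iff₀ (by positivity)] at h3
  linarith

theorem mainTheorem2 (ε : ℝ) (hε0 : 0 < ε) (hε1 : ε ≤ 1) :
    expansionExponent ε = ((1 / ε - 1 : ℝ) : EReal) ∧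
    (ε < 1 →
      IsHereditary (epsSubdivisionClass ε Set.univ) ∧
      HasSepExponent (epsSubdivisionClass ε Set.univ) ε ∧
      (∀ r : ℕ, IsShallowMinor r
        (⊤ : SimpleGraph (Fin ⌊(r : ℝ) ^ (1 / ε - 1)⌋₊))
        (epsSubdivision ε (⊤ : SimpleGraph (Fin ⌊(r : ℝ) ^ (1 / ε - 1)⌋₊)))) ∧
      NablaIsBigOmega (epsSubdivisionClass ε Set.univ) (1 / ε - 1)) := by
  refine ⟨le_antisymm ?_ ?_, fun h => ⟨isHereditary_epsSubdivisionClass ε _,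
    hasSepExponent_epsSubdivisionClass hε0 h, isShallowMinor_epsSubdivision_top hε0 h,
    nablaIsBigOmega_epsSubdivisionClass hε0 h⟩⟩
  · refine EReal.le_of_forall_lt_iff_le.1 fun B hB => ?_
    exact iInf₂_le B fun 𝒢 h𝒢 hs =>
      nablaIsBigO_of_hasSepExponent hε0 hε1 (EReal.coe_lt_coe_iff.1 hB) h𝒢 hs
  · refine le_iInf₂ fun B hB => EReal.coe_le_coe_iff.2 ?_
    rcases lt_or_eq_of_le hε1 with h | rfl
    · exact le_of_nablaIsBigOmega_of_nablaIsBigO (nablaIsBigOmega_epsSubdivisionClass hε0 h)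
        (hB _ (isHereditary_epsSubdivisionClass ε _) (hasSepExponent_epsSubdivisionClass hε0 h))
    · obtain ⟨𝒢, h1, h2, h3⟩ := exists_class_of_exponent_one
      have := le_of_nablaIsBigOmega_of_nablaIsBigO h3 (hB 𝒢 h1 h2)
      linarith
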